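/- **Setting.** Let $A=(A^s)_{1\le s\le d}$ be complex $\chi\times\chi$ matrices forming an injective translation-invariant MPS tensor in left-canonical form: $\sum_s A^{s\dagger}A^s=\mathbb 1$, $\sum_s A^s\rho A^{s\dagger}=\rho$ for some positive definite $\rho$, the eigenvalue $1$ of the transfer matrix $\sum_s A^s\otimes (A^s)^*$ has a one-dimensional eigenspace, and all its other eigenvalues have modulus less than $1$. For $n\ge 1$ let $|\psi_n\rangle=\sum_{s_1,\dots,s_n}\mathrm{Tr}(A^{s_1}\cdots A^{s_n})|s_1\dots s_n\rangle$. Let $G$ be a (discrete) abelian group, $U:G\to U(d)$ an on-site unitary linear representation, $b\in\mathbb Z$ and $L\ge 1$ with $U_g^{\,b^L}=U_g$ for all $g$. The MPS has the exponential symmetry $\mathcal T(g)=g^b$ of period $L$ if for all $k\ge1$ and $g\in G$ the state $|\psi_{kL}\rangle$ satisfies $\bigotimes_{j=0}^{kL-1}U_g^{\,b^{j}}|\psi_{kL}\rangle=e^{i\theta}|\psi_{kL}\rangle$ for some phase $e^{i\theta}$ (depending on $k,g$). Virtual bond unitaries are unitary $\chi\times\chi$ matrices $v_j(g)$ ($j\ge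 0$, $g\in G$) such that, up to a phase independent of $s$, $\sum_{t}(U_g^{\,b^j})_{st}A^t \doteq v_j(g)^\dagger A^s v_{j+1}(g)$ for all $s$, and $v_j(g)v_j(h)=\omega_j(g,h)\,v_j(gh)$ with $\omega_j(g,h)\in U(1)$; $\omega_j$ is the virtual cocycle. **(1) Constraint.** For every injective MPS with exponential symmetry $\mathcal T(g)=g^b$ as above, virtual bond unitaries exist. For any choice of them, $v_{j+1}(g)\doteq v_j(g^b)$ up to a phase, each $\omega_j$ is a 2-cocycle, its class in $H^2(G,U(1))$ does not depend on $j$ or on the choice of the bond unitaries, and, up to coboundaries, $$\omega_j(g,h)=\omega_j(g^b,h^b)=\omega_j(g,h)^{b^2},\qquad\text{hence}\qquad \omega_j^{\,b^2-1}=1 .$$ **(2) Classification for $G=\mathbb Z_N\times\mathbb Z_N$.** Let $N\ge1$ and let $b$ be an integer coprime to $N$. Then there is $L\ge 1$ with $g^{b^L}=g$ for all $g\in G$. There is an isomorphism $H^2(G,U(1))\cong\mathbb Z_N$, $[\omega]\mapsto k$, where $k$ is determined by $\omega(g,h)\,\omega(h,g)^{-1}=e^{2\pi i k/N}$ with $g,h$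 the generators of the two factors. For every $L\ge1$ with $g^{b^L}=g$ for all $g\in G$, let the SPT phases be the classes in $H^2(G,U(1))$ carried by the virtual bonds of injective MPS with exponential symmetry $\mathcal T(g)=g^b$ of period $L$ and with $G$ represented linearly on each site. A class is an SPT phase if and only if its label $k$ is a multiple of $N/\gcd(b^2-1,N)$ in $\mathbb Z_N$; every such class is also realized with a faithful on-site representation. The SPT phases form a subgroup of $H^2(G,U(1))$ isomorphic to $\mathbb Z_{\gcd(b^2-1,N)}$. -/

import Mathlib

open scoped Matrix Kronecker ComplexOrder

universe u

noncomputable section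

namespace ExpSPT

/-! ### Matrix product states -/

/-- A translation-invariant MPS tensor: the same family of `χ × χ` matrices `A s`, labelled by the
on-site basis states `s`, is used on every site. -/
abbrev MPSTensor (d χ : ℕ) : Type := Fin d → Matrix (Fin χ) (Fin χ) ℂ

/-- The amplitudes `Tr (A^{s₁} ⋯ A^{sₙ})` of the MPS on a periodic chain of `n` sites. -/
def mpsState {d χ : ℕ} (A : MPSTensor d χ) (n : ℕ) : (Fin n → Fin d) → ℂ :=
  fun s => (List.ofFn fun i => A (s i)).prod.trace

/-- The transfer matrix `∑ₛ Aˢ ⊗ (Aˢ)^*` (`*` is entrywise complex conjugation). On a matrix `X`,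
seen as a vector indexed by pairs, it acts as `X ↦ ∑ₛ Aˢ X (Aˢ)ᴴ`. -/
def transferMatrix {d χ : ℕ} (A : MPSTensor d χ) :
    Matrix (Fin χ × Fin χ) (Fin χ × Fin χ) ℂ :=
  ∑ s, (A s) ⊗ₖ ((A s).map star)

/-- An injective MPS tensor in left-canonical form: the identity and a full-rank positive definite
`ρ` are the left and right dominant eigenvectors (eigenvalue `1`) of the transfer matrix, the
dominant eigenvector is unique, and all other eigenvalues have modulus less than `1`. -/
structure IsInjectiveMPS {d χ : ℕ} (A : MPSTensor d χ) : Prop where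
  left_canonical : ∑ s, (A s)ᴴ * A s = 1
  right_canonical : ∃ ρ : Matrix (Fin χ) (Fin χ) ℂ, ρ.PosDef ∧ ∑ s, A s * ρ * (A s)ᴴ = ρ
  unique_dominant :
    Module.finrank ℂ (Module.End.eigenspace (Matrix.toLin' (transferMatrix A)) (1 : ℂ)) = 1
  gap : ∀ μ : ℂ, Module.End.HasEigenvalue (Matrix.toLin' (transferMatrix A)) μ → μ ≠ 1 → ‖μ‖ < 1

/-! ### Exponential symmetries -/

/-- The tensor product operator `W₀ ⊗ W₁ ⊗ ⋯ ⊗ W_{n-1}` on a chain of `n` sites. -/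
def siteTensor {d : ℕ} (n : ℕ) (W : ℕ → Matrix (Fin d) (Fin d) ℂ) :
    Matrix (Fin n → Fin d) (Fin n → Fin d) ℂ :=
  Matrix.of fun s t => ∏ j : Fin n, W (j : ℕ) (s j) (t j)

/-- The on-site unitary of the group element `g` on site `j` (sites are counted from `0`):
`U_g ^ (b ^ j)`. -/
def onSite {G : Type*} [CommGroup G] {d : ℕ} (U : G →* Matrix.unitaryGroup (Fin d) ℂ) (b : ℤ)
    (g : G) (j : ℕ) : Matrix (Fin d) (Fin d) ℂ :=
  ((U g ^ (b ^ j) : Matrix.unitaryGroup (Fin d) ℂ) : Matrix (Fin d) (Fin d) ℂ)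

/-- The MPS of `A` has the exponential symmetry `⨂ⱼ U_g ^ (b ^ j)`, of period `L`: the symmetry
is compatible with the periodic chain of `L` sites, and for all `k ≥ 1` the MPS on `k L` sites is
an eigenstate of the `k`-fold periodic extension of the symmetry operator. -/
structure HasExpSymmetry {G : Type*} [CommGroup G] {d χ : ℕ} (A : MPSTensor d χ)
    (U : G →* Matrix.unitaryGroup (Fin d) ℂ) (b : ℤ) (L : ℕ) : Prop where
  periodic : ∀ g : G, U g ^ (b ^ L) = U g
  eigenstate : ∀ k : ℕ, 1 ≤ k → ∀ g : G, ∃ θ : Circle,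
    siteTensor (k * L) (onSite U b g) *ᵥ mpsState A (k * L) = (θ : ℂ) • mpsState A (k * L)

/-- The action `(W · A)ˢ = ∑ₜ W_{s t} Aᵗ` of an operator on the physical leg. -/
def physAct {d χ : ℕ} (W : Matrix (Fin d) (Fin d) ℂ) (A : MPSTensor d χ) : MPSTensor d χ :=
  fun s => ∑ t, W s t • A t

/-- `v` is a family of virtual bond unitaries for the exponential symmetry, with (virtual) factor
system `ω j` on bond `j`: site `j` lies between the bonds `j` and `j + 1`, the symmetry is pushed
through the tensor on site `j`, up to a phase, to `v_j(g)ᴴ` and `v_{j+1}(g)`, and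
`v_j(g) v_j(h) = ω_j(g,h) v_j(g h)`. -/
structure IsVirtualRep {G : Type*} [CommGroup G] {d χ : ℕ} (A : MPSTensor d χ)
    (U : G →* Matrix.unitaryGroup (Fin d) ℂ) (b : ℤ)
    (v : ℕ → G → Matrix.unitaryGroup (Fin χ) ℂ) (ω : ℕ → G → G → Circle) : Prop where
  push_through : ∀ (j : ℕ) (g : G), ∃ φ : Circle, ∀ s : Fin d,
    physAct (onSite U b g j) A s =
      (φ : ℂ) • ((v j g : Matrix (Fin χ) (Fin χ) ℂ)ᴴ * A s *
        (v (j + 1) g : Matrix (Fin χ) (Fin χ) ℂ))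
  projective : ∀ (j : ℕ) (g h : G),
    (v j g : Matrix (Fin χ) (Fin χ) ℂ) * (v j h : Matrix (Fin χ) (Fin χ) ℂ) =
      (ω j g h : ℂ) • (v j (g * h) : Matrix (Fin χ) (Fin χ) ℂ)

/-! ### Cocycles with values in `U(1)` -/

/-- `ω` is a `U(1)`-valued 2-cocycle (trivial action). -/
def IsTwoCocycle {G : Type*} [CommGroup G] (ω : G → G → Circle) : Prop :=
  ∀ g h l : G, ω g h * ω (g * h) l = ω h l * ω g (h * l)

/-- `ω = 1` up to coboundaries. -/
def IsTwoCoboundary {G : Type*} [CommGroup G] (ω : G → G → Circle) : Prop :=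
  ∃ β : G → Circle, ∀ g h : G, ω g h = β g * β h / β (g * h)

/-- `ω = ω'` up to coboundaries. -/
def Cohomologous {G : Type*} [CommGroup G] (ω ω' : G → G → Circle) : Prop :=
  IsTwoCoboundary fun g h => ω g h / ω' g h

/-- `U(1)` with trivial `G`-action, written additively. -/
abbrev u1Rep (G : Type) [CommGroup G] : Rep ℤ G := Rep.trivial ℤ G (Additive Circle)

/-- The group cohomology `H²(G, U(1))`. -/
abbrev H2U1 (G : Type) [CommGroup G] := groupCohomology.H2 (u1Rep G)

/-- The value at `(g, h)` of a `U(1)`-valued 2-cocycle, as a complex number of modulus one. -/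
def cocycleVal {G : Type} [CommGroup G] (x : groupCohomology.cocycles₂ (u1Rep G)) (g h : G) :
    Circle :=
  Additive.toMul (α := Circle) (x (g, h))

/-- The virtual bonds of the MPS of `A` carry the projective class `c ∈ H²(G, U(1))`. -/
def CarriesClass {G : Type} [CommGroup G] {d χ : ℕ} (A : MPSTensor d χ)
    (U : G →* Matrix.unitaryGroup (Fin d) ℂ) (b : ℤ) (c : H2U1 G) : Prop :=
  ∃ (v : ℕ → G → Matrix.unitaryGroup (Fin χ) ℂ) (ω : ℕ → G → G → Circle)
    (x : groupCohomology.cocycles₂ (u1Rep G)),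
    IsVirtualRep A U b v ω ∧ (∀ g h : G, cocycleVal x g h = ω 0 g h) ∧
      groupCohomology.H2π (u1Rep G) x = c

/-- The SPT phases protected by the exponential symmetry `T(g) = g ^ b` of period `L`, with
on-site group `G` represented linearly on every site: the projective classes carried by the
virtual bonds of translation-invariant injective MPS with this symmetry. -/
def sptPhases (G : Type) [CommGroup G] (b : ℤ) (L : ℕ) : Set (H2U1 G) :=
  {c | ∃ (d χ : ℕ) (A : MPSTensor d χ) (U : G →* Matrix.unitaryGroup (Fin d) ℂ),
    IsInjectiveMPS A ∧ HasExpSymmetry A U b L ∧ CarriesClass A U b c}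

/-- The group `ℤ_N × ℤ_N`, written multiplicatively. -/
abbrev ZN2 (N : ℕ) : Type := Multiplicative (ZMod N) × Multiplicative (ZMod N)

/-- The generator of the first factor of `ℤ_N × ℤ_N`. -/
def gen₁ (N : ℕ) : ZN2 N := (Multiplicative.ofAdd 1, 1)

/-- The generator of the second factor of `ℤ_N × ℤ_N`. -/
def gen₂ (N : ℕ) : ZN2 N := (1, Multiplicative.ofAdd 1)

end ExpSPT

end

namespace ExpSPT
open Module Filter Topology

/-! Fix `g`. The tensors B_j obtained by letting U_g^(b^j) act on A are again left canonical, and on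
every chain of kL sites they give the state of A up to a phase. The overlap of the two states is the
trace of the k-th power of one product M of mixed transfer matrices. It has the modulus of Tr
T^(kL), which tends to a positive integer, so Mᴴ has an eigenvalue of modulus at least 1
(`exists_mixedOrbit_eigenvector`). The maps Y ↦ ∑ₛ B_jˢᴴ Y Aˢ contract the norm Tr(Y ρ Yᴴ), and
equality forces Y_j Aˢ = B_jˢ Y_{j+1} (`sum_wnorm_defect`). The orbit of the eigenvector therefore
intertwines the tensors. Rigidity (`IsInjectiveMPS.eq_smul_one_of_intertwines`) makes Y_jᴴ Y_j
scalar, and rescaling yields unitaries (`IsInjectiveMPS.exists_unitary_gauge`). The same rigidity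
makes bond unitaries unique up to phases, hence projective in `g`.

The constraint combines two facts. The on-site representation is linear, so the bonds j and j+1
carry the same class; and site j+1 sees `g` as site j sees `g ^ b`, so v_{j+1}(g) ≐ v_j(g^b). On an
abelian group the commutator of a cocycle is a bicharacter that determines its class: a symmetric
cocycle gives an abelian extension by the divisible group U(1), which splits
(`isTwoCoboundary_of_symmetric`). Pulling back along `g ↦ g ^ b` raises the bicharacter to the power
b².

Conversely, let a class be killed by b² - 1, and let V be the regular representation twisted by a
cocycle ω of it. On a tensor whose physical leg is a pair of virtual legs, V̄(g) ⊗ V(g^b) has factor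
system ω(g^b, h^b)/ω(g, h), a coboundary, so a phase makes it linear (`exists_mps_of_projective`).
For ℤ_N × ℤ_N the commutator of the generators identifies H² with ℤ_N, and the phases are its (b² -
1)-torsion. -/

/-! ### Traces of powers and eigenvalues. -/

theorem trace_pow_of_isNilpotent_sub {V : Type*} [AddCommGroup V] [Module ℂ V]
    [FiniteDimensional ℂ V] (g : End ℂ V) (μ : ℂ) (hg : IsNilpotent (g - algebraMap ℂ _ μ))
    (k : ℕ) :
    LinearMap.trace ℂ V (g ^ k) = μ ^ k * (finrank ℂ V : ℂ) := by
  induction k with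
  | zero => simp
  | succ k ih =>
    rw [pow_succ, Module.End.mul_eq_comp,
      LinearMap.trace_comp_eq_mul_of_commute_of_isNilpotent μ (Commute.pow_left rfl k) hg, ih]
    ring

theorem maxGenEigenspace_ne_bot_iff {V : Type*} [AddCommGroup V] [Module ℂ V] (f : End ℂ V)
    (μ : ℂ) : f.maxGenEigenspace μ ≠ ⊥ ↔ f.HasEigenvalue μ :=
  Module.End.hasUnifEigenvalue_iff_hasUnifEigenvalue_one (k := ⊤) (by simp)

/-- The traces of the powers of an endomorphism are the power sums of its eigenvalues. -/
theorem exists_trace_pow_eq_sum {V : Type*} [AddCommGroup V] [Module ℂ V]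
    [FiniteDimensional ℂ V] (f : End ℂ V) :
    ∃ (s : Finset ℂ) (m : ℂ → ℕ), (∀ μ, μ ∈ s ↔ f.HasEigenvalue μ) ∧ (∀ μ ∈ s, 0 < m μ) ∧
      ∀ k : ℕ, LinearMap.trace ℂ V (f ^ k) = ∑ μ ∈ s, μ ^ k * (m μ : ℂ) := by
  have hds : DirectSum.IsInternal f.maxGenEigenspace :=
    (DirectSum.isInternal_submodule_iff_iSupIndep_and_iSup_eq_top _).mpr
      ⟨f.independent_maxGenEigenspace, f.iSup_maxGenEigenspace_eq_top⟩
  have hfin : {μ | f.maxGenEigenspace μ ≠ ⊥}.Finite :=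
    WellFoundedGT.finite_ne_bot_of_iSupIndep f.independent_maxGenEigenspace
  refine ⟨hfin.toFinset, fun μ => finrank ℂ (f.maxGenEigenspace μ), fun μ => ?_, fun μ hμ => ?_,
    fun k => ?_⟩
  · simp only [Set.Finite.mem_toFinset, Set.mem_ofPred_eq]
    exact maxGenEigenspace_ne_bot_iff f μ
  · simp only [Set.Finite.mem_toFinset, Set.mem_ofPred_eq] at hμ
    have := Submodule.nontrivial_iff_ne_bot.mpr hμ
    exact finrank_pos
  · have hmap : ∀ μ, Set.MapsTo f (f.maxGenEigenspace μ) (f.maxGenEigenspace μ) :=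
      fun μ => f.mapsTo_maxGenEigenspace_of_comm rfl μ
    have hmapk : ∀ μ, Set.MapsTo (f ^ k) (f.maxGenEigenspace μ) (f.maxGenEigenspace μ) :=
      fun μ => f.mapsTo_maxGenEigenspace_of_comm (Commute.pow_right rfl k) μ
    rw [LinearMap.trace_eq_sum_trace_restrict' hds hfin hmapk]
    refine Finset.sum_congr rfl fun μ _ => ?_
    rw [← Module.End.pow_restrict k (hmap μ)]
    refine trace_pow_of_isNilpotent_sub _ μ ?_ k
    exact f.isNilpotent_restrict_maxGenEigenspace_sub_algebraMap μ

theorem tendsto_trace_pow_zero {V : Type*} [AddCommGroup V] [Module ℂ V]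
    [FiniteDimensional ℂ V] (f : End ℂ V) (h : ∀ μ, f.HasEigenvalue μ → ‖μ‖ < 1) :
    Tendsto (fun k : ℕ => LinearMap.trace ℂ V (f ^ k)) atTop (𝓝 0) := by
  obtain ⟨s, m, hs, -, ht⟩ := exists_trace_pow_eq_sum f
  simp_rw [ht]
  rw [← Finset.sum_const_zero (s := s)]
  refine tendsto_finsetSum _ fun μ hμ => ?_
  simpa using (tendsto_pow_atTop_nhds_zero_of_norm_lt_one (h μ ((hs μ).1 hμ))).mul_const (m μ : ℂ)

/-- All power sums decay except the contribution of the eigenvalue 1, so the limit is its algebraic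
multiplicity. -/
theorem exists_tendsto_trace_pow {V : Type*} [AddCommGroup V] [Module ℂ V]
    [FiniteDimensional ℂ V] (f : End ℂ V) (h1 : f.HasEigenvalue 1)
    (h : ∀ μ, f.HasEigenvalue μ → μ ≠ 1 → ‖μ‖ < 1) :
    ∃ m : ℕ, 0 < m ∧ Tendsto (fun k : ℕ => LinearMap.trace ℂ V (f ^ k)) atTop (𝓝 (m : ℂ)) := by
  obtain ⟨s, m, hs, hm, ht⟩ := exists_trace_pow_eq_sum f
  refine ⟨m 1, hm 1 ((hs 1).2 h1), ?_⟩
  simp_rw [ht]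
  rw [show (m 1 : ℂ) = ∑ μ ∈ s, if μ = 1 then (m 1 : ℂ) else 0 by simp [(hs 1).2 h1]]
  refine tendsto_finsetSum _ fun μ hμ => ?_
  split_ifs with hμ1
  · subst hμ1; simp
  · simpa using
      (tendsto_pow_atTop_nhds_zero_of_norm_lt_one (h μ ((hs μ).1 hμ) hμ1)).mul_const (m μ : ℂ)

/-- A linear endomorphism all of whose eigenvalues are `1`, and which preserves a definite
quadratic form `q` with polar form `B`, is the identity. -/
theorem eq_one_of_preserves_of_eigenvalue_eq_one {V : Type*} [AddCommGroup V] [Module ℂ V]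
    [FiniteDimensional ℂ V] (f : End ℂ V) (q : V → ℝ) (B : V → V → ℝ)
    (hq : ∀ x, q x = 0 → x = 0)
    (hB : ∀ (x y : V) (n : ℕ), q (x + (n : ℂ) • y) = q x + n * B x y + n ^ 2 * q y)
    (hf : ∀ x, q (f x) = q x) (h1 : ∀ μ, f.HasEigenvalue μ → μ = 1) : f = 1 := by
  -- A Jordan block of size two would make `q` vary along x, x + y, x + 2y. Invariance at the first
  -- two steps already forces `q y = 0`.
  have hdouble : ∀ x, (f - 1) ((f - 1) x) = 0 → (f - 1) x = 0 := by
    intro x hx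
    set y := (f - 1) x with hy
    have e1 : f x = x + ((1 : ℕ) : ℂ) • y := by simp [hy]
    have e2 : f y = y := by simpa [sub_eq_zero] using hx
    have e3 : f (f x) = x + ((2 : ℕ) : ℂ) • y := by
      rw [e1, map_add, map_smul, e2, e1]; push_cast; module
    have r1 := hf x
    have r2 := hf (f x)
    rw [hf x, e3, hB] at r2
    rw [e1, hB] at r1
    push_cast at r1 r2
    exact hq _ (by linarith)
  have hpow : ∀ (n : ℕ) (x : V), ((f - 1) ^ n) x = 0 → (f - 1) x = 0 := by
    intro n
    induction n with
    | zero => intro x hx; simp only [pow_zero, Module.End.one_apply] at hx; simp [hx]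
    | succ n ih =>
      intro x hx
      rw [pow_succ, Module.End.mul_apply] at hx
      exact hdouble x (ih _ hx)
  have htop : f.maxGenEigenspace 1 = ⊤ := by
    rw [← f.iSup_maxGenEigenspace_eq_top]
    refine le_antisymm (le_iSup _ _) (iSup_le fun μ => ?_)
    by_cases hμ : f.maxGenEigenspace μ = ⊥
    · simp [hμ]
    · rw [h1 μ]
      exact (maxGenEigenspace_ne_bot_iff f μ).1 hμ
  ext x
  have hx : x ∈ f.maxGenEigenspace 1 := htop ▸ Submodule.mem_top
  obtain ⟨n, hn⟩ := Module.End.mem_maxGenEigenspace f 1 x |>.1 hx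
  rw [one_smul] at hn
  simpa [sub_eq_zero] using hpow n x hn

/-! ### Products along the chain and mixed transfer matrices. -/

theorem prod_ofFn_sum {R : Type*} [Semiring R] {d : ℕ} (n : ℕ) (M : ℕ → Fin d → R) :
    (List.ofFn fun i : Fin n => ∑ s, M i s).prod =
      ∑ s : Fin n → Fin d, (List.ofFn fun i : Fin n => M i (s i)).prod := by
  induction n generalizing M with
  | zero => simp
  | succ n ih =>
    rw [List.ofFn_succ, List.prod_cons, ← (Fin.consEquiv fun _ => Fin d).sum_comp,
      Fintype.sum_prod_type]
    have := ih fun i => M (i + 1)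
    simp only [Fin.val_succ] at this ⊢
    rw [this, Finset.sum_mul_sum]
    simp [Fin.consEquiv, List.ofFn_succ]

theorem prod_ofFn_smul {R : Type*} [Semiring R] [Algebra ℂ R] (n : ℕ) (c : Fin n → ℂ)
    (M : Fin n → R) :
    (List.ofFn fun i => c i • M i).prod = (∏ i, c i) • (List.ofFn M).prod := by
  induction n with
  | zero => simp
  | succ n ih =>
    simp [List.ofFn_succ, ih, Fin.prod_univ_succ, smul_smul, mul_comm]

/-- The symmetry operator acts on the MPS by acting on the physical legs of the tensors. -/
theorem siteTensor_mulVec_mpsState {d χ : ℕ} (A : MPSTensor d χ) (n : ℕ)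
    (W : ℕ → Matrix (Fin d) (Fin d) ℂ) (s : Fin n → Fin d) :
    (siteTensor n W *ᵥ mpsState A n) s =
      (List.ofFn fun i : Fin n => physAct (W i) A (s i)).prod.trace := by
  -- The family must be indexed by all of ℕ; the value 0 beyond the chain is never read.
  have h := prod_ofFn_sum n fun i t => if h : i < n then W i (s ⟨i, h⟩) t • A t else 0
  simp only [Fin.is_lt, dite_true, Fin.eta] at h
  simp only [physAct]
  rw [h, Matrix.trace_sum]
  simp [Matrix.mulVec, dotProduct, siteTensor, mpsState, prod_ofFn_smul]

theorem prod_ofFn_kronecker {χ : ℕ} (n : ℕ) (P Q : Fin n → Matrix (Fin χ) (Fin χ) ℂ) :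
    (List.ofFn fun i => P i ⊗ₖ Q i).prod = (List.ofFn P).prod ⊗ₖ (List.ofFn Q).prod := by
  induction n with
  | zero => simp
  | succ n ih => simp [List.ofFn_succ, ih, Matrix.mul_kronecker_mul]

theorem prod_ofFn_map_star {χ : ℕ} (n : ℕ) (P : Fin n → Matrix (Fin χ) (Fin χ) ℂ) :
    (List.ofFn fun i => (P i).map star).prod = (List.ofFn P).prod.map star := by
  induction n with
  | zero => simp
  | succ n ih =>
    simp only [List.ofFn_succ, List.prod_cons, ih]
    exact ((starRingEnd ℂ).mapMatrix.map_mul _ _).symm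

/-- The mixed transfer matrix `∑ₛ Bˢ ⊗ (Aˢ)^*` of two tensors. -/
def mixedTransfer {d χ : ℕ} (B A : MPSTensor d χ) :
    Matrix (Fin χ × Fin χ) (Fin χ × Fin χ) ℂ :=
  ∑ s, B s ⊗ₖ (A s).map star

/-- The trace is multiplicative on Kronecker products, so an overlap of two states becomes a single
trace. -/
theorem sum_trace_mul_star_trace {d χ : ℕ} (B : ℕ → MPSTensor d χ) (A : MPSTensor d χ) (n : ℕ) :
    ∑ s : Fin n → Fin d, (List.ofFn fun i : Fin n => B i (s i)).prod.trace * star (mpsState A n s) =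
      (List.ofFn fun i : Fin n => mixedTransfer (B i) A).prod.trace := by
  simp only [mixedTransfer]
  rw [prod_ofFn_sum n fun i s => B i s ⊗ₖ (A s).map star, Matrix.trace_sum]
  refine Finset.sum_congr rfl fun s _ => ?_
  rw [prod_ofFn_kronecker, Matrix.trace_kronecker, prod_ofFn_map_star]
  congr 1
  exact (AddMonoidHom.map_trace (starRingEnd ℂ : ℂ →+ ℂ) _)

/-- The action of the conjugate transpose of a mixed transfer matrix. -/
def mixedMap {d χ : ℕ} (B A : MPSTensor d χ) :
    End ℂ (Matrix (Fin χ) (Fin χ) ℂ) :=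
  ∑ s, LinearMap.mulLeft ℂ (B s)ᴴ ∘ₗ LinearMap.mulRight ℂ (A s)

theorem mixedMap_apply {d χ : ℕ} (B A : MPSTensor d χ) (X : Matrix (Fin χ) (Fin χ) ℂ) :
    mixedMap B A X = ∑ s, (B s)ᴴ * X * A s := by
  simp [mixedMap, Matrix.mul_assoc]

/-- Matrices as vectors indexed by pairs. -/
def vecEquiv (χ : ℕ) : Matrix (Fin χ) (Fin χ) ℂ ≃ₗ[ℂ] (Fin χ × Fin χ → ℂ) :=
  (LinearEquiv.curry ℂ ℂ (Fin χ) (Fin χ)).symm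

theorem vecEquiv_apply {χ : ℕ} (X : Matrix (Fin χ) (Fin χ) ℂ) (p : Fin χ × Fin χ) :
    vecEquiv χ X p = X p.1 p.2 := rfl

/-- The adjoint is the useful direction: for B = A the resulting map X ↦ ∑ₛ Aˢᴴ X Aˢ fixes the
identity in left-canonical form. -/
theorem kronecker_map_star_conjTranspose_mulVec {χ : ℕ} (P Q X : Matrix (Fin χ) (Fin χ) ℂ) :
    (P ⊗ₖ Q.map star)ᴴ *ᵥ vecEquiv χ X = vecEquiv χ (Pᴴ * X * Q) := by
  ext ⟨i, j⟩
  simp only [Matrix.mulVec, dotProduct, Fintype.sum_prod_type, vecEquiv_apply, Matrix.mul_apply,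
    Matrix.conjTranspose_apply, Matrix.kronecker_apply, Matrix.map_apply, Finset.sum_mul]
  rw [Finset.sum_comm]
  refine Finset.sum_congr rfl fun k _ => Finset.sum_congr rfl fun l _ => ?_
  simp only [star_mul', star_star]
  ring

theorem mixedTransfer_conjTranspose_mulVec {d χ : ℕ} (B A : MPSTensor d χ)
    (X : Matrix (Fin χ) (Fin χ) ℂ) :
    (mixedTransfer B A)ᴴ *ᵥ vecEquiv χ X = vecEquiv χ (mixedMap B A X) := by
  simp only [mixedTransfer, Matrix.conjTranspose_sum, Matrix.sum_mulVec,
    kronecker_map_star_conjTranspose_mulVec, mixedMap_apply, map_sum]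

theorem toLin'_mixedTransfer_conjTranspose {d χ : ℕ} (B A : MPSTensor d χ) :
    Matrix.toLin' (mixedTransfer B A)ᴴ = (vecEquiv χ).conj (mixedMap B A) := by
  apply LinearMap.ext
  intro x
  obtain ⟨X, rfl⟩ := (vecEquiv χ).surjective x
  simp [mixedTransfer_conjTranspose_mulVec, LinearEquiv.conj_apply]

/-! ### The weighted norm and the isometry defect. -/

/-- The squared norm `Tr (X ρ Xᴴ)`. -/
def wnorm {χ : ℕ} (ρ X : Matrix (Fin χ) (Fin χ) ℂ) : ℝ := (X * ρ * Xᴴ).trace.re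

section wnorm

variable {d χ : ℕ} {ρ : Matrix (Fin χ) (Fin χ) ℂ}

theorem wnorm_eq_sum (X : Matrix (Fin χ) (Fin χ) ℂ) :
    wnorm ρ X = ∑ i, (star (star (X i)) ⬝ᵥ ρ *ᵥ star (X i)).re := by
  simp only [wnorm, Matrix.trace, Matrix.diag, Complex.re_sum]
  refine Finset.sum_congr rfl fun i _ => ?_
  rw [Matrix.mul_assoc, Matrix.mul_apply]
  simp [dotProduct, Matrix.mulVec, Matrix.mul_apply]

theorem wnorm_nonneg (hρ : ρ.PosDef) (X : Matrix (Fin χ) (Fin χ) ℂ) : 0 ≤ wnorm ρ X :=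
  (Complex.nonneg_iff.1 (hρ.posSemidef.mul_mul_conjTranspose_same X).trace_nonneg).1

theorem wnorm_eq_zero (hρ : ρ.PosDef) {X : Matrix (Fin χ) (Fin χ) ℂ} (h : wnorm ρ X = 0) :
    X = 0 := by
  rw [wnorm_eq_sum, Finset.sum_eq_zero_iff_of_nonneg fun i _ =>
    (Complex.nonneg_iff.1 (hρ.posSemidef.dotProduct_mulVec_nonneg _)).1] at h
  ext i j
  by_contra hij
  have hi : star (X i) ≠ 0 := fun h0 => hij (by simpa using congrFun h0 j)
  exact (Complex.pos_iff.1 (hρ.dotProduct_mulVec_pos hi)).1.ne' (h i (Finset.mem_univ i))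

theorem wnorm_smul (c : ℂ) (X : Matrix (Fin χ) (Fin χ) ℂ) :
    wnorm ρ (c • X) = ‖c‖ ^ 2 * wnorm ρ X := by
  have : (c • X) * ρ * (c • X)ᴴ = ((‖c‖ ^ 2 : ℝ) : ℂ) • (X * ρ * Xᴴ) := by
    rw [Matrix.conjTranspose_smul, Matrix.smul_mul, Matrix.smul_mul, Matrix.mul_smul, smul_smul,
      Complex.ofReal_pow, ← Complex.mul_conj']
    rfl
  rw [wnorm, this, Matrix.trace_smul, smul_eq_mul, Complex.re_ofReal_mul, wnorm]

theorem wnorm_add_smul (X Y : Matrix (Fin χ) (Fin χ) ℂ) (n : ℕ) :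
    wnorm ρ (X + (n : ℂ) • Y) =
      wnorm ρ X + n * (X * ρ * Yᴴ + Y * ρ * Xᴴ).trace.re + n ^ 2 * wnorm ρ Y := by
  have : (X + (n : ℂ) • Y) * ρ * (X + (n : ℂ) • Y)ᴴ =
      X * ρ * Xᴴ + ((n : ℝ) : ℂ) • (X * ρ * Yᴴ + Y * ρ * Xᴴ) +
        ((n ^ 2 : ℝ) : ℂ) • (Y * ρ * Yᴴ) := by
    rw [Matrix.conjTranspose_add, Matrix.conjTranspose_smul]
    simp only [add_mul, mul_add, Matrix.smul_mul, Matrix.mul_smul, smul_add, smul_smul]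
    simp [sq]
    abel
  rw [wnorm, this]
  simp only [Matrix.trace_add, Matrix.trace_smul, Complex.add_re, smul_eq_mul,
    Complex.re_ofReal_mul, wnorm, mul_add]

/-- The failure of `mixedMap B A` to be isometric is the failure of `Y` to intertwine. -/
theorem sum_wnorm_defect {A B : MPSTensor d χ} (hB : ∑ s, (B s)ᴴ * B s = 1)
    (hρA : ∑ s, A s * ρ * (A s)ᴴ = ρ) (Y : Matrix (Fin χ) (Fin χ) ℂ) :
    ∑ s, wnorm ρ (Y * A s - B s * mixedMap B A Y) = wnorm ρ Y - wnorm ρ (mixedMap B A Y) := by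
  set F := mixedMap B A Y with hF
  have hF' : ∑ s, (B s)ᴴ * Y * A s = F := (mixedMap_apply B A Y).symm
  have hF'' : ∑ s, (A s)ᴴ * Yᴴ * B s = Fᴴ := by
    rw [← hF', Matrix.conjTranspose_sum]
    simp [Matrix.mul_assoc]
  have e1 : ∑ s, ((Y * A s) * ρ * (Y * A s)ᴴ).trace = (Y * ρ * Yᴴ).trace := by
    rw [← Matrix.trace_sum]
    conv_rhs => rw [← hρA]
    simp [Matrix.mul_sum, Matrix.sum_mul, Matrix.mul_assoc]
  have e2 : ∑ s, ((Y * A s) * ρ * (B s * F)ᴴ).trace = (F * ρ * Fᴴ).trace := by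
    rw [show (F * ρ * Fᴴ).trace = ((∑ s, (B s)ᴴ * Y * A s) * ρ * Fᴴ).trace by rw [hF']]
    rw [Matrix.sum_mul, Matrix.sum_mul, Matrix.trace_sum]
    refine Finset.sum_congr rfl fun s _ => ?_
    rw [Matrix.conjTranspose_mul, ← Matrix.mul_assoc, Matrix.trace_mul_comm]
    simp [Matrix.mul_assoc]
  have e3 : ∑ s, ((B s * F) * ρ * (Y * A s)ᴴ).trace = (F * ρ * Fᴴ).trace := by
    conv_rhs => rw [← hF'']
    rw [Matrix.mul_sum, Matrix.trace_sum]
    refine Finset.sum_congr rfl fun s _ => ?_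
    rw [Matrix.mul_assoc (B s), Matrix.mul_assoc (B s), Matrix.trace_mul_comm]
    simp [Matrix.mul_assoc]
  have e4 : ∑ s, ((B s * F) * ρ * (B s * F)ᴴ).trace = (F * ρ * Fᴴ).trace := by
    have : (F * ρ * Fᴴ).trace = (F * ρ * Fᴴ * ∑ s, (B s)ᴴ * B s).trace := by rw [hB, mul_one]
    rw [this, Matrix.mul_sum, Matrix.trace_sum]
    refine Finset.sum_congr rfl fun s _ => ?_
    rw [Matrix.mul_assoc (B s), Matrix.mul_assoc (B s), Matrix.trace_mul_comm]
    simp [Matrix.mul_assoc]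
  simp only [wnorm, Matrix.conjTranspose_sub, Matrix.sub_mul, Matrix.mul_sub, Matrix.trace_sub]
  rw [← Complex.re_sum]
  simp only [Finset.sum_sub_distrib]
  rw [e1, e2, e3, e4]
  simp

/-- The defect is a sum of squared norms, hence nonnegative; when it vanishes, every summand does,
which is the intertwining relation. -/
theorem wnorm_mixedMap_le {A B : MPSTensor d χ} (hB : ∑ s, (B s)ᴴ * B s = 1)
    (hρ : ρ.PosDef) (hρA : ∑ s, A s * ρ * (A s)ᴴ = ρ) (Y : Matrix (Fin χ) (Fin χ) ℂ) :
    wnorm ρ (mixedMap B A Y) ≤ wnorm ρ Y := by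
  have := sum_wnorm_defect hB hρA Y
  have h0 : 0 ≤ ∑ s, wnorm ρ (Y * A s - B s * mixedMap B A Y) :=
    Finset.sum_nonneg fun s _ => wnorm_nonneg hρ _
  linarith

theorem intertwines_of_wnorm_mixedMap_eq {A B : MPSTensor d χ} (hB : ∑ s, (B s)ᴴ * B s = 1)
    (hρ : ρ.PosDef) (hρA : ∑ s, A s * ρ * (A s)ᴴ = ρ) {Y : Matrix (Fin χ) (Fin χ) ℂ}
    (h : wnorm ρ (mixedMap B A Y) = wnorm ρ Y) (s : Fin d) :
    Y * A s = B s * mixedMap B A Y := by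
  have := sum_wnorm_defect hB hρA Y
  rw [h, sub_self, Finset.sum_eq_zero_iff_of_nonneg fun s _ => wnorm_nonneg hρ _] at this
  exact sub_eq_zero.1 (wnorm_eq_zero hρ (this s (Finset.mem_univ s)))

theorem wnorm_mixedMap_eq_of_intertwines {A B : MPSTensor d χ} (hB : ∑ s, (B s)ᴴ * B s = 1)
    (hρA : ∑ s, A s * ρ * (A s)ᴴ = ρ) {Y : Matrix (Fin χ) (Fin χ) ℂ}
    (h : ∀ s, Y * A s = B s * mixedMap B A Y) :
    wnorm ρ (mixedMap B A Y) = wnorm ρ Y := by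
  have := sum_wnorm_defect hB hρA Y
  simp only [h, sub_self] at this
  have h0 : wnorm ρ (0 : Matrix (Fin χ) (Fin χ) ℂ) = 0 := by simp [wnorm]
  rw [h0] at this
  simp at this
  linarith

end wnorm

/-! ### Spectral data of the adjoint, and rigidity of injective tensors. -/

theorem hasEigenvalue_toLin'_conjTranspose {n : Type*} [Fintype n] [DecidableEq n]
    {M : Matrix n n ℂ} {μ : ℂ} (h : End.HasEigenvalue (Matrix.toLin' Mᴴ) μ) :
    End.HasEigenvalue (Matrix.toLin' M) (star μ) := by
  rw [Module.End.hasEigenvalue_iff_mem_spectrum, Matrix.spectrum_toLin'] at h ⊢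
  rw [← Matrix.star_eq_conjTranspose, spectrum.map_star] at h
  exact h

/-- A matrix and its adjoint have the same rank, so uniqueness of the dominant eigenvector passes to
the adjoint. -/
theorem finrank_eigenspace_one_conjTranspose {n : Type*} [Fintype n] [DecidableEq n]
    (M : Matrix n n ℂ) :
    finrank ℂ (End.eigenspace (Matrix.toLin' Mᴴ) 1) =
      finrank ℂ (End.eigenspace (Matrix.toLin' M) 1) := by
  have key : ∀ K : Matrix n n ℂ,
      K.rank - 0 + finrank ℂ (LinearMap.ker (Matrix.toLin' K)) = Fintype.card n := by
    intro K
    rw [Nat.sub_zero, Matrix.rank, ← Matrix.toLin'_apply', LinearMap.finrank_range_add_finrank_ker,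
      finrank_fintype_fun_eq_card]
  have he : ∀ K : Matrix n n ℂ,
      End.eigenspace (Matrix.toLin' K) 1 = LinearMap.ker (Matrix.toLin' (K - 1)) := by
    intro K
    rw [End.eigenspace_def, map_sub, Matrix.toLin'_one, one_smul]
    rfl
  rw [he, he]
  have h1 := key (M - 1)
  have h2 := key (M - 1)ᴴ
  rw [Matrix.rank_conjTranspose] at h2
  rw [show Mᴴ - 1 = (M - 1)ᴴ by simp]
  omega

theorem hasEigenvalue_conj {V W : Type*} [AddCommGroup V] [Module ℂ V] [AddCommGroup W] [Module ℂ W]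
    (e : V ≃ₗ[ℂ] W) {f : End ℂ V} {μ : ℂ} (h : f.HasEigenvalue μ) :
    End.HasEigenvalue (e.conj f) μ := by
  obtain ⟨x, hx⟩ := h.exists_hasEigenvector
  refine End.hasEigenvalue_of_hasEigenvector (x := e x) ⟨?_, ?_⟩
  · rw [End.mem_eigenspace_iff, LinearEquiv.conj_apply_apply, e.symm_apply_apply,
      hx.apply_eq_smul, map_smul]
  · simpa using hx.2

section Rigidity

variable {d χ : ℕ} {A : MPSTensor d χ}

theorem IsInjectiveMPS.nonempty (hA : IsInjectiveMPS A) : Nonempty (Fin χ) := by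
  by_contra h
  rw [not_nonempty_iff] at h
  have := hA.unique_dominant
  rw [finrank_zero_of_subsingleton] at this
  exact one_ne_zero this.symm

theorem IsInjectiveMPS.gap_mixedMap (hA : IsInjectiveMPS A) {μ : ℂ}
    (h : (mixedMap A A).HasEigenvalue μ) (h1 : μ ≠ 1) : ‖μ‖ < 1 := by
  have h2 := hasEigenvalue_conj (vecEquiv χ) h
  rw [← toLin'_mixedTransfer_conjTranspose] at h2
  have h3 := hasEigenvalue_toLin'_conjTranspose h2
  have := hA.gap _ h3 fun h => h1 (by simpa using congrArg star h)
  simpa using this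

theorem IsInjectiveMPS.mixedMap_one (hA : IsInjectiveMPS A) : mixedMap A A 1 = 1 := by
  simp [mixedMap_apply, hA.left_canonical]

theorem IsInjectiveMPS.eq_smul_one_of_fixed (hA : IsInjectiveMPS A)
    {X : Matrix (Fin χ) (Fin χ) ℂ} (h : mixedMap A A X = X) : ∃ c : ℂ, X = c • 1 := by
  have := hA.nonempty
  have hfr : finrank ℂ (End.eigenspace (Matrix.toLin' (mixedTransfer A A)ᴴ) 1) = 1 := by
    rw [finrank_eigenspace_one_conjTranspose]
    exact hA.unique_dominant
  have hmem : ∀ Z, mixedMap A A Z = Z →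
      vecEquiv χ Z ∈ End.eigenspace (Matrix.toLin' (mixedTransfer A A)ᴴ) 1 := by
    intro Z hZ
    rw [End.mem_eigenspace_iff, Matrix.toLin'_apply, mixedTransfer_conjTranspose_mulVec, hZ,
      one_smul]
  have h1 := hmem 1 hA.mixedMap_one
  obtain ⟨c, hc⟩ := (finrank_eq_one_iff_of_nonzero' (⟨_, h1⟩ : End.eigenspace _ _) (by
    simp [Subtype.ext_iff])).1 hfr ⟨_, hmem X h⟩
  refine ⟨c, (vecEquiv χ).injective ?_⟩
  rw [map_smul]
  exact (congrArg Subtype.val hc).symm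

/-- A matrix that can be pushed through arbitrarily many sites of an injective MPS is scalar. -/
theorem IsInjectiveMPS.eq_smul_one_of_intertwines (hA : IsInjectiveMPS A)
    {X : Matrix (Fin χ) (Fin χ) ℂ}
    (h : ∀ (n : ℕ) (s : Fin d),
      (mixedMap A A ^ n) X * A s = A s * (mixedMap A A ^ (n + 1)) X) : ∃ c : ℂ, X = c • 1 := by
  obtain ⟨ρ, hρ, hρA⟩ := hA.right_canonical
  have := hA.nonempty
  set f := mixedMap A A with hf
  -- This subspace is stable under `f`, and `f` is isometric on it. Eigenvalues there have modulus
  -- 1, so by the gap they equal 1, and definiteness of the norm excludes Jordan blocks. Thus `f` is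
  -- the identity on `S`, and its fixed points are scalar.
  let S : Submodule ℂ (Matrix (Fin χ) (Fin χ) ℂ) :=
    { carrier := {X | ∀ (n : ℕ) (s : Fin d), (f ^ n) X * A s = A s * (f ^ (n + 1)) X}
      add_mem' := fun {a b} ha hb n s => by simp only [map_add, add_mul, mul_add, ha n s, hb n s]
      zero_mem' := fun n s => by simp
      smul_mem' := fun c a ha n s => by
        simp only [map_smul, Matrix.smul_mul, Matrix.mul_smul, ha n s] }
  have hS : ∀ Z ∈ S, f Z ∈ S := fun Z hZ n s => by
    have := hZ (n + 1) s
    simpa only [pow_succ, Module.End.mul_apply] using this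
  have hiso : ∀ Z ∈ S, wnorm ρ (f Z) = wnorm ρ Z := fun Z hZ =>
    wnorm_mixedMap_eq_of_intertwines hA.left_canonical hρA fun s => by simpa using hZ 0 s
  have hone : f.restrict hS = 1 := by
    refine eq_one_of_preserves_of_eigenvalue_eq_one (f.restrict hS) (fun Z => wnorm ρ Z)
      (fun X Y => (X.1 * ρ * Y.1ᴴ + Y.1 * ρ * X.1ᴴ).trace.re)
      (fun Z hZ => Subtype.ext (wnorm_eq_zero hρ hZ)) (fun X Y n => wnorm_add_smul X.1 Y.1 n)
      (fun Z => hiso Z Z.2) fun μ hμ => ?_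
    obtain ⟨Z, hZ⟩ := hμ.exists_hasEigenvector
    have hZ0 : (Z : Matrix (Fin χ) (Fin χ) ℂ) ≠ 0 := by simpa using hZ.2
    have hfZ : f Z = μ • (Z : Matrix (Fin χ) (Fin χ) ℂ) := congrArg Subtype.val hZ.apply_eq_smul
    by_contra hμ1
    have hlt := hA.gap_mixedMap
      (End.hasEigenvalue_of_hasEigenvector ⟨End.mem_eigenspace_iff.2 hfZ, hZ0⟩) hμ1
    have hw := hiso Z Z.2
    rw [hfZ, wnorm_smul] at hw
    have hpos : 0 < wnorm ρ (Z : Matrix (Fin χ) (Fin χ) ℂ) :=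
      (wnorm_nonneg hρ _).lt_of_ne fun h0 => hZ0 (wnorm_eq_zero hρ h0.symm)
    have : ‖μ‖ ^ 2 < 1 := by
      have := norm_nonneg μ
      nlinarith
    nlinarith
  refine hA.eq_smul_one_of_fixed ?_
  exact congrArg Subtype.val (LinearMap.congr_fun hone ⟨X, h⟩)

end Rigidity

/-! ### Existence of a unitary gauge. -/

theorem prod_ofFn_succ_last {M : Type*} [Monoid M] (X : ℕ → M) (n : ℕ) :
    (List.ofFn fun i : Fin (n + 1) => X i).prod = (List.ofFn fun i : Fin n => X i).prod * X n := by
  rw [List.ofFn_succ', List.prod_concat]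
  rfl

theorem prod_ofFn_add {M : Type*} [Monoid M] (X : ℕ → M) (n m : ℕ) :
    (List.ofFn fun i : Fin (n + m) => X i).prod =
      (List.ofFn fun i : Fin n => X i).prod * (List.ofFn fun i : Fin m => X (n + i)).prod := by
  induction m with
  | zero => simp
  | succ m ih =>
    rw [← Nat.add_assoc n m 1, prod_ofFn_succ_last X (n + m), ih,
      prod_ofFn_succ_last (fun i => X (n + i)) m, mul_assoc]

theorem prod_ofFn_periodic {M : Type*} [Monoid M] (X : ℕ → M) (L : ℕ)
    (hX : ∀ j, X (j + L) = X j) (k : ℕ) :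
    (List.ofFn fun i : Fin (k * L) => X i).prod = (List.ofFn fun i : Fin L => X i).prod ^ k := by
  induction k with
  | zero => simp
  | succ k ih =>
    have hk : ∀ (k j : ℕ), X (k * L + j) = X j := by
      intro k j
      induction k with
      | zero => simp
      | succ k ih => rw [Nat.add_mul, one_mul, add_right_comm, hX, ih]
    rw [Nat.add_mul, one_mul, prod_ofFn_add, ih, pow_succ]
    simp only [hk]

theorem sum_conjTranspose_mul_physAct {d χ : ℕ} {W : Matrix (Fin d) (Fin d) ℂ} (hW : Wᴴ * W = 1)
    (A : MPSTensor d χ) :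
    ∑ s, (physAct W A s)ᴴ * physAct W A s = ∑ s, (A s)ᴴ * A s := by
  simp only [physAct, Matrix.conjTranspose_sum, Matrix.conjTranspose_smul, Finset.sum_mul_sum,
    Matrix.smul_mul, Matrix.mul_smul, smul_smul]
  rw [Finset.sum_comm]
  refine Finset.sum_congr rfl fun t _ => ?_
  rw [Finset.sum_comm]
  have : ∀ u, ∑ s, (star (W s t) * W s u) • ((A t)ᴴ * A u) =
      if t = u then (A t)ᴴ * A u else 0 := by
    intro u
    rw [← Finset.sum_smul]
    have := congrFun (congrFun hW t) u
    simp only [Matrix.mul_apply, Matrix.conjTranspose_apply, Matrix.one_apply] at this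
    rw [this]
    split_ifs <;> simp
  simp only [mul_comm (W _ _), this, Finset.sum_ite_eq, Finset.mem_univ, if_true]

theorem trace_pow_toLin' {n : Type*} [Fintype n] [DecidableEq n] (M : Matrix n n ℂ) (k : ℕ) :
    LinearMap.trace ℂ (n → ℂ) (Matrix.toLin' M ^ k) = (M ^ k).trace := by
  rw [← Matrix.toLin'_pow, Matrix.trace_toLin'_eq]

theorem hasEigenvalue_transferMatrix_one {d χ : ℕ} {A : MPSTensor d χ} (hA : IsInjectiveMPS A) :
    End.HasEigenvalue (Matrix.toLin' (transferMatrix A)) 1 := by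
  intro h
  have := hA.unique_dominant
  rw [End.genEigenspace_one] at h
  rw [End.eigenspace_def, h] at this
  simp at this

/-- The orbit of `Y` under the maps `Y ↦ ∑ₛ (Bⱼˢ)ᴴ Y Aˢ`. -/
def mixedOrbit {d χ : ℕ} (B : ℕ → MPSTensor d χ) (A : MPSTensor d χ)
    (Y : Matrix (Fin χ) (Fin χ) ℂ) : ℕ → Matrix (Fin χ) (Fin χ) ℂ
  | 0 => Y
  | j + 1 => mixedMap (B j) A (mixedOrbit B A Y j)

/-- Taking the adjoint reverses the product, so site 0 acts first. -/
theorem prod_mixedTransfer_conjTranspose_mulVec {d χ : ℕ} (B : ℕ → MPSTensor d χ)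
    (A : MPSTensor d χ) (Y : Matrix (Fin χ) (Fin χ) ℂ) (n : ℕ) :
    (List.ofFn fun i : Fin n => mixedTransfer (B i) A).prodᴴ *ᵥ vecEquiv χ Y =
      vecEquiv χ (mixedOrbit B A Y n) := by
  induction n with
  | zero => simp [mixedOrbit]
  | succ n ih =>
    rw [prod_ofFn_succ_last fun i => mixedTransfer (B i) A, Matrix.conjTranspose_mul,
      ← Matrix.mulVec_mulVec, ih, mixedTransfer_conjTranspose_mulVec, mixedOrbit]

section Existence

variable {d χ : ℕ} {A : MPSTensor d χ}

/-- If every eigenvalue of the adjoint of one period had modulus below 1, the overlaps would tend to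
0. Their moduli equal the norms squared of the MPS, which tend to a positive multiplicity. -/
theorem IsInjectiveMPS.exists_mixedOrbit_eigenvector (hA : IsInjectiveMPS A)
    (B : ℕ → MPSTensor d χ) (L : ℕ) (hL : 0 < L) (hper : ∀ j, B (j + L) = B j)
    (hstate : ∀ k : ℕ, 1 ≤ k → ∃ θ : Circle, ∀ s : Fin (k * L) → Fin d,
      (List.ofFn fun i : Fin (k * L) => B i (s i)).prod.trace = (θ : ℂ) * mpsState A (k * L) s) :
    ∃ (Y : Matrix (Fin χ) (Fin χ) ℂ) (μ : ℂ), Y ≠ 0 ∧ 1 ≤ ‖μ‖ ∧ mixedOrbit B A Y L = μ • Y := by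
  set M := (List.ofFn fun i : Fin L => mixedTransfer (B i) A).prod with hM
  set T := transferMatrix A with hT
  have hMk : ∀ k, 1 ≤ k → ‖(Mᴴ ^ k).trace‖ = ‖(T ^ (k * L)).trace‖ := by
    intro k hk
    obtain ⟨θ, hθ⟩ := hstate k hk
    have h1 := sum_trace_mul_star_trace B A (k * L)
    have h2 := sum_trace_mul_star_trace (fun _ => A) A (k * L)
    rw [prod_ofFn_periodic (fun i => mixedTransfer (B i) A) L (fun j => by simp only [hper]) k,
      ← hM] at h1
    rw [List.ofFn_const, List.prod_replicate] at h2
    rw [← Matrix.conjTranspose_pow, Matrix.trace_conjTranspose, norm_star, ← h1]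
    change _ = ‖(mixedTransfer A A ^ (k * L)).trace‖
    rw [← h2]
    simp only [hθ, mul_assoc]
    rw [← Finset.mul_sum, norm_mul, Circle.norm_coe, one_mul]
    rfl
  obtain ⟨μ, hμ, hμ1⟩ : ∃ μ, End.HasEigenvalue (Matrix.toLin' Mᴴ) μ ∧ 1 ≤ ‖μ‖ := by
    by_contra! hcon
    have h0 := (tendsto_trace_pow_zero _ hcon).norm
    obtain ⟨m, hm, hlim⟩ := exists_tendsto_trace_pow (Matrix.toLin' T)
      (hasEigenvalue_transferMatrix_one hA) hA.gap
    have hkL : Tendsto (fun k : ℕ => k * L) atTop atTop :=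
      tendsto_id.atTop_mul_const' hL
    have h1 := (hlim.comp hkL).norm
    simp only [trace_pow_toLin', Function.comp_def] at h0 h1
    have h2 := h0.congr' ((eventually_ge_atTop 1).mono hMk)
    have := tendsto_nhds_unique h1 h2
    simp at this
    omega
  obtain ⟨x, hx⟩ := hμ.exists_hasEigenvector
  obtain ⟨Y, rfl⟩ := (vecEquiv χ).surjective x
  refine ⟨Y, μ, fun h => hx.2 (by simp [h]), hμ1, (vecEquiv χ).injective ?_⟩
  rw [← prod_mixedTransfer_conjTranspose_mulVec, map_smul, ← hx.apply_eq_smul, Matrix.toLin'_apply]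

/-- Two families of left-canonical tensors that produce the same states (up to phases) on the
chains of `k L` sites, one of which is constant and injective, are related by a unitary gauge. -/
theorem IsInjectiveMPS.exists_unitary_gauge (hA : IsInjectiveMPS A)
    (B : ℕ → MPSTensor d χ) (hB : ∀ j, ∑ s, (B j s)ᴴ * B j s = 1) (L : ℕ) (hL : 0 < L)
    (hper : ∀ j, B (j + L) = B j)
    (hstate : ∀ k : ℕ, 1 ≤ k → ∃ θ : Circle, ∀ s : Fin (k * L) → Fin d,
      (List.ofFn fun i : Fin (k * L) => B i (s i)).prod.trace = (θ : ℂ) * mpsState A (k * L) s) :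
    ∃ v : ℕ → Matrix.unitaryGroup (Fin χ) ℂ, ∀ j s,
      B j s = (v j : Matrix (Fin χ) (Fin χ) ℂ)ᴴ * A s * (v (j + 1) : Matrix (Fin χ) (Fin χ) ℂ) := by
  obtain ⟨Y₀, μ, hY₀, hμ, hYL⟩ := hA.exists_mixedOrbit_eigenvector B L hL hper hstate
  obtain ⟨ρ, hρ, hρA⟩ := hA.right_canonical
  set Y := mixedOrbit B A Y₀ with hY
  have hYper : ∀ j, Y (j + L) = μ • Y j := by
    intro j
    induction j with
    | zero => simpa [hY, mixedOrbit] using hYL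
    | succ j ih =>
      rw [add_right_comm]
      change mixedMap (B (j + L)) A (Y (j + L)) = μ • mixedMap (B j) A (Y j)
      rw [hper, ih, map_smul]
  have hanti : Antitone fun j => wnorm ρ (Y j) :=
    antitone_nat_of_succ_le fun j => wnorm_mixedMap_le (hB j) hρ hρA (Y j)
  have hpos : 0 < wnorm ρ Y₀ :=
    (wnorm_nonneg hρ _).lt_of_ne fun h0 => hY₀ (wnorm_eq_zero hρ h0.symm)
  -- The norms decrease along the orbit, yet after one period they return multiplied by ‖μ‖² ≥ 1.
  -- Hence they are constant, and ‖μ‖ = 1.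
  have hge : ∀ j, wnorm ρ (Y j) ≤ wnorm ρ (Y (j + L)) := fun j => by
    rw [hYper, wnorm_smul]
    have := wnorm_nonneg hρ (Y j)
    have h1 : 1 ≤ ‖μ‖ ^ 2 := one_le_pow₀ hμ
    nlinarith
  have hconst : ∀ j, wnorm ρ (Y (j + 1)) = wnorm ρ (Y j) := fun j =>
    le_antisymm (hanti (Nat.le_succ j)) ((hge j).trans (hanti (by omega)))
  have hinter : ∀ j s, Y j * A s = B j s * Y (j + 1) := fun j s =>
    intertwines_of_wnorm_mixedMap_eq (hB j) hρ hρA (hconst j) s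
  have hμ2 : star μ * μ = 1 := by
    have h0 : wnorm ρ (Y L) = wnorm ρ (Y 0) :=
      le_antisymm (hanti (Nat.zero_le L)) (by simpa using hge 0)
    have h1 := hYper 0
    rw [zero_add] at h1
    rw [h1, wnorm_smul] at h0
    have h2 : ‖μ‖ ^ 2 = 1 := by
      have : wnorm ρ (Y 0) ≠ 0 := hpos.ne'
      field_simp at h0
      exact h0
    have := Complex.conj_mul' μ
    rw [show star μ = (starRingEnd ℂ) μ from rfl, this]
    exact_mod_cast h2
  -- Intertwining and left canonicity of `B n` carry Y_nᴴ Y_n to Y_{n+1}ᴴ Y_{n+1} under the map of A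
  -- alone. The phase μ cancels, so this orbit is periodic, its decreasing norm is constant, and
  -- rigidity applies.
  have hpow : ∀ n, (mixedMap A A ^ n) ((Y 0)ᴴ * Y 0) = (Y n)ᴴ * Y n := by
    intro n
    induction n with
    | zero => simp
    | succ n ih =>
      rw [pow_succ', Module.End.mul_apply, ih, mixedMap_apply]
      have : ∀ s, (A s)ᴴ * ((Y n)ᴴ * Y n) * A s =
          (Y (n + 1))ᴴ * ((B n s)ᴴ * B n s) * Y (n + 1) := by
        intro s
        have h1 := hinter n s
        calc _ = (Y n * A s)ᴴ * (Y n * A s) := by simp [Matrix.mul_assoc]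
          _ = _ := by rw [h1]; simp [Matrix.mul_assoc]
      simp only [this]
      rw [← Matrix.sum_mul, ← Matrix.mul_sum, hB, mul_one]
  have hPper : ∀ n, (mixedMap A A ^ (n + L)) ((Y 0)ᴴ * Y 0) =
      (mixedMap A A ^ n) ((Y 0)ᴴ * Y 0) := by
    intro n
    rw [hpow, hpow, hYper, Matrix.conjTranspose_smul, Matrix.smul_mul, Matrix.mul_smul, smul_smul,
      hμ2, one_smul]
  have hPanti : Antitone fun n => wnorm ρ ((mixedMap A A ^ n) ((Y 0)ᴴ * Y 0)) :=
    antitone_nat_of_succ_le fun n => by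
      rw [pow_succ', Module.End.mul_apply]
      exact wnorm_mixedMap_le hA.left_canonical hρ hρA _
  obtain ⟨c, hc⟩ := hA.eq_smul_one_of_intertwines (X := (Y 0)ᴴ * Y 0) fun n s => by
    rw [pow_succ' _ n, Module.End.mul_apply]
    refine intertwines_of_wnorm_mixedMap_eq hA.left_canonical hρ hρA ?_ s
    rw [← Module.End.mul_apply, ← pow_succ']
    refine le_antisymm (hPanti (Nat.le_succ n)) ?_
    have := hPanti (show n + 1 ≤ n + L by omega)
    simp only [hPper] at this
    exact this
  have hcY : ∀ n, (Y n)ᴴ * Y n = c • 1 := by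
    intro n
    rw [← hpow n, hc, map_smul]
    congr 1
    induction n with
    | zero => simp
    | succ n ih => rw [pow_succ, Module.End.mul_apply, hA.mixedMap_one, ih]
  obtain ⟨i₀⟩ := hA.nonempty
  have hcreal : ∃ r : ℝ, 0 < r ∧ c = ((r * r : ℝ) : ℂ) := by
    have h1 : c = (∑ k, ‖Y 0 k i₀‖ ^ 2 : ℝ) := by
      have := congrFun (congrFun (hcY 0) i₀) i₀
      simp only [Matrix.mul_apply, Matrix.conjTranspose_apply, Matrix.smul_apply,
        Matrix.one_apply_eq, smul_eq_mul, mul_one] at this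
      rw [← this]
      push_cast
      refine Finset.sum_congr rfl fun k _ => ?_
      exact Complex.conj_mul' _
    have h2 : 0 ≤ (∑ k, ‖Y 0 k i₀‖ ^ 2 : ℝ) := Finset.sum_nonneg fun k _ => sq_nonneg _
    have h3 : c ≠ 0 := by
      rintro rfl
      have := hcY 0
      rw [zero_smul, Matrix.conjTranspose_mul_self_eq_zero] at this
      exact hY₀ this
    refine ⟨√(∑ k, ‖Y 0 k i₀‖ ^ 2 : ℝ), Real.sqrt_pos.2 (h2.lt_of_ne fun h => h3 ?_), ?_⟩
    · rw [h1, ← h]; simp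
    · rw [Real.mul_self_sqrt h2, ← h1]
  obtain ⟨r, hr, rfl⟩ := hcreal
  have hr' : (r : ℂ) ≠ 0 := by exact_mod_cast hr.ne'
  have hu : ∀ n, ((r : ℂ)⁻¹ • (Y n)ᴴ) * ((r : ℂ)⁻¹ • (Y n)ᴴ)ᴴ = 1 := by
    intro n
    rw [Matrix.conjTranspose_smul, Matrix.conjTranspose_conjTranspose, Matrix.smul_mul,
      Matrix.mul_smul, hcY, smul_smul, smul_smul]
    have : star ((r : ℂ)⁻¹) = (r : ℂ)⁻¹ := by simp
    rw [this]
    push_cast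
    rw [show (r : ℂ)⁻¹ * (r : ℂ)⁻¹ * (r * r) = 1 by field_simp, one_smul]
  -- As Y_nᴴ Y_n = r², dividing by r gives a unitary. The adjoint appears because Y_j Aˢ = B_jˢ
  -- Y_{j+1} places Y_j in the role of v_jᴴ.
  refine ⟨fun n => ⟨(r : ℂ)⁻¹ • (Y n)ᴴ, Matrix.mem_unitaryGroup_iff.2 (hu n)⟩, fun j s => ?_⟩
  have hu' : ((r : ℂ)⁻¹ • (Y (j + 1))ᴴ)ᴴ * ((r : ℂ)⁻¹ • (Y (j + 1))ᴴ) = 1 :=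
    mul_eq_one_comm.1 (hu (j + 1))
  have : ((r : ℂ)⁻¹ • (Y j)ᴴ)ᴴ * A s = B j s * ((r : ℂ)⁻¹ • (Y (j + 1))ᴴ)ᴴ := by
    simp only [Matrix.conjTranspose_smul, Matrix.conjTranspose_conjTranspose, Matrix.smul_mul,
      Matrix.mul_smul, hinter]
  change _ = ((r : ℂ)⁻¹ • (Y j)ᴴ)ᴴ * A s * ((r : ℂ)⁻¹ • (Y (j + 1))ᴴ)
  rw [this, Matrix.mul_assoc, hu', mul_one]

end Existence

/-! ### Cocycles on abelian groups and their commutators. -/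

noncomputable section Cohomology

/-- The commutator of a cocycle. -/
def cocycleComm {G : Type*} (ω : G → G → Circle) (g h : G) : Circle := ω g h / ω h g

theorem cocycleComm_swap {G : Type*} (ω : G → G → Circle) (g h : G) :
    cocycleComm ω h g = (cocycleComm ω g h)⁻¹ := by
  simp [cocycleComm]

variable {G : Type*} [CommGroup G]

theorem isTwoCoboundary_div {ω ω' : G → G → Circle} (h : IsTwoCoboundary ω)
    (h' : IsTwoCoboundary ω') : IsTwoCoboundary fun g k => ω g k / ω' g k := by
  obtain ⟨β, hβ⟩ := h
  obtain ⟨β', hβ'⟩ := h'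
  refine ⟨fun g => β g / β' g, fun g k => ?_⟩
  simp only [hβ, hβ']
  rw [div_div_div_comm, mul_div_mul_comm]

theorem Cohomologous.refl (ω : G → G → Circle) : Cohomologous ω ω :=
  ⟨fun _ => 1, fun g k => by simp⟩

theorem Cohomologous.symm {ω ω' : G → G → Circle} (h : Cohomologous ω ω') : Cohomologous ω' ω := by
  obtain ⟨β, hβ⟩ := h
  refine ⟨fun g => (β g)⁻¹, fun g k => ?_⟩
  have := congrArg (·⁻¹) (hβ g k)
  simp only [inv_div] at this
  change ω' g k / ω g k = (β g)⁻¹ * (β k)⁻¹ / (β (g * k))⁻¹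
  rw [this, div_eq_mul_inv, div_eq_mul_inv, inv_inv, mul_inv, mul_comm]

theorem Cohomologous.trans {ω₁ ω₂ ω₃ : G → G → Circle} (h : Cohomologous ω₁ ω₂)
    (h' : Cohomologous ω₂ ω₃) : Cohomologous ω₁ ω₃ := by
  have h2 := isTwoCoboundary_div h h'.symm
  unfold Cohomologous
  convert h2 using 3 with g k
  rw [div_div_div_eq, mul_comm, mul_div_mul_left_eq_div]

/-- The cocycle identities at (g,h,l), (l,g,h) and (g,l,h) combine to this one, once commutativity
of G matches the arguments. -/
theorem cocycleComm_mul_left {ω : G → G → Circle} (hω : IsTwoCocycle ω) (g h l : G) :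
    cocycleComm ω (g * h) l = cocycleComm ω g l * cocycleComm ω h l := by
  have h1 := congrArg Additive.ofMul (hω g h l)
  have h2 := congrArg Additive.ofMul (hω l g h)
  have h3 := congrArg Additive.ofMul (hω g l h)
  apply Additive.ofMul.injective
  simp only [cocycleComm, ofMul_mul, ofMul_div] at h1 h2 h3 ⊢
  rw [mul_comm l g] at h2
  rw [mul_comm l h] at h3
  rw [← sub_eq_zero] at h1 h2 h3 ⊢
  have : ∀ x y z : Additive Circle, x = 0 → y = 0 → z = 0 → x + y - z = 0 := by
    rintro _ _ _ rfl rfl rfl; simp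
  have := this _ _ _ h1 h2 h3
  rw [← this]
  abel

/-- The commutator of a cocycle on an abelian group, as a character in its first argument. -/
def cocycleCommHom {ω : G → G → Circle} (hω : IsTwoCocycle ω) (l : G) : G →* Circle :=
  MonoidHom.mk' (fun g => cocycleComm ω g l) fun g h => cocycleComm_mul_left hω g h l

theorem cocycleComm_zpow_left {ω : G → G → Circle} (hω : IsTwoCocycle ω) (g l : G) (n : ℤ) :
    cocycleComm ω (g ^ n) l = cocycleComm ω g l ^ n :=
  map_zpow (cocycleCommHom hω l) g n

theorem cocycleComm_zpow_right {ω : G → G → Circle} (hω : IsTwoCocycle ω) (g l : G) (n : ℤ) :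
    cocycleComm ω g (l ^ n) = cocycleComm ω g l ^ n := by
  rw [cocycleComm_swap, cocycleComm_zpow_left hω, cocycleComm_swap ω g l, inv_zpow, inv_inv]

theorem cocycleComm_mul_right {ω : G → G → Circle} (hω : IsTwoCocycle ω) (g h l : G) :
    cocycleComm ω g (h * l) = cocycleComm ω g h * cocycleComm ω g l := by
  rw [cocycleComm_swap, cocycleComm_mul_left hω, mul_inv, ← cocycleComm_swap, ← cocycleComm_swap]

/-- Cocycles are not assumed normalized; this controls the resulting factors ω(1,1). -/
theorem IsTwoCocycle.one_left {ω : G → G → Circle} (hω : IsTwoCocycle ω) (g : G) :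
    ω 1 g = ω 1 1 := by
  have := hω 1 1 g
  simp only [one_mul, mul_one] at this
  exact (mul_right_cancel this).symm

/-- The extension of `G` by `U(1)` with a given cocycle. -/
@[ext]
structure CocycleExt (ω : G → G → Circle) where
  /-- the group element -/
  elt : G
  /-- the phase -/
  phase : Circle

/-- The abelian group structure on the extension given by a symmetric cocycle. -/
abbrev CocycleExt.commGroup {ω : G → G → Circle} (hω : IsTwoCocycle ω)
    (hs : ∀ g h, ω g h = ω h g) : CommGroup (CocycleExt ω) :=
  letI : Mul (CocycleExt ω) := ⟨fun x y => ⟨x.elt * y.elt, x.phase * y.phase * ω x.elt y.elt⟩⟩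
  -- The phase compensates for ω(1,1), which need not be 1.
  letI : One (CocycleExt ω) := ⟨⟨1, (ω 1 1)⁻¹⟩⟩
  letI : Inv (CocycleExt ω) := ⟨fun x => ⟨x.elt⁻¹, (x.phase * ω x.elt x.elt⁻¹ * ω 1 1)⁻¹⟩⟩
  { Group.ofLeftAxioms (G := CocycleExt ω)
      (fun x y z => CocycleExt.ext (mul_assoc x.elt y.elt z.elt) (by
        change x.phase * y.phase * ω x.elt y.elt * z.phase * ω (x.elt * y.elt) z.elt =
          x.phase * (y.phase * z.phase * ω y.elt z.elt) * ω x.elt (y.elt * z.elt)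
        calc _ = x.phase * y.phase * z.phase * (ω x.elt y.elt * ω (x.elt * y.elt) z.elt) := by
              simp only [mul_comm, mul_left_comm]
          _ = _ := by rw [hω]; simp only [mul_comm, mul_left_comm]))
      (fun x => CocycleExt.ext (one_mul x.elt) (by
        change (ω 1 1)⁻¹ * x.phase * ω 1 x.elt = x.phase
        rw [hω.one_left x.elt, mul_comm _ x.phase, mul_assoc, inv_mul_cancel, mul_one]))
      (fun x => CocycleExt.ext (inv_mul_cancel x.elt) (by
        change (x.phase * ω x.elt x.elt⁻¹ * ω 1 1)⁻¹ * x.phase * ω x.elt⁻¹ x.elt = (ω 1 1)⁻¹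
        rw [hs x.elt⁻¹ x.elt, mul_assoc, mul_inv_rev, mul_assoc, inv_mul_cancel, mul_one])) with
    mul_comm := fun x y => CocycleExt.ext (mul_comm x.elt y.elt) (by
      change x.phase * y.phase * ω x.elt y.elt = y.phase * x.phase * ω y.elt x.elt
      rw [hs, mul_comm x.phase]) }

/-- `U(1)` is a divisible group. -/
@[reducible]
def circleDivisible : DivisibleBy (Additive Circle) ℤ :=
  divisibleByOfSMulRightSurj _ _ fun {n} hn a => by
    refine ⟨Additive.ofMul (Circle.exp (Complex.arg (Additive.toMul a : Circle) / n)), ?_⟩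
    apply Additive.toMul.injective
    rw [toMul_zsmul, toMul_ofMul, ← Circle.exp_zsmul, zsmul_eq_mul,
      mul_div_cancel₀ _ (Int.cast_ne_zero.2 hn), Circle.exp_arg]

/-- Symmetry makes the extension abelian. U(1) is divisible, hence injective, so the inclusion of
U(1) has a retraction; its values on the section g ↦ (g, 1) form the trivializing cochain. -/
theorem isTwoCoboundary_of_symmetric {ω : G → G → Circle} (hω : IsTwoCocycle ω)
    (hs : ∀ g h, ω g h = ω h g) : IsTwoCoboundary ω := by
  let := CocycleExt.commGroup hω hs
  let ι : Circle →* CocycleExt ω := MonoidHom.mk' (fun a => ⟨1, a * (ω 1 1)⁻¹⟩) fun a b =>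
    CocycleExt.ext (one_mul 1).symm (by
      change a * b * (ω 1 1)⁻¹ = (a * (ω 1 1)⁻¹) * (b * (ω 1 1)⁻¹) * ω 1 1
      rw [mul_assoc (a * _), inv_mul_cancel_right, mul_right_comm])
  have hι : Function.Injective ι := fun a b h =>
    mul_right_cancel (congrArg CocycleExt.phase h)
  have := circleDivisible
  obtain ⟨r, hr⟩ := (Module.Baer.of_divisible (Additive Circle)).extension_property_addMonoidHom
    (MonoidHom.toAdditive ι) hι (AddMonoidHom.id _)
  let r' : CocycleExt ω →* Circle := AddMonoidHom.toMultiplicative r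
  have hr' : ∀ a, r' (ι a) = a := fun a => DFunLike.congr_fun hr (Additive.ofMul a)
  refine ⟨fun g => r' ⟨g, 1⟩, fun g h => ?_⟩
  rw [eq_div_iff_mul_eq', ← map_mul]
  conv_lhs => rw [← hr' (ω g h)]
  rw [← map_mul]
  congr 1
  refine CocycleExt.ext ?_ ?_
  · exact one_mul (g * h)
  · change ω g h * (ω 1 1)⁻¹ * 1 * ω 1 (g * h) = 1 * 1 * ω g h
    rw [hω.one_left (g * h), mul_one, inv_mul_cancel_right, one_mul, one_mul]

theorem isTwoCoboundary_of_cocycleComm_eq_one {ω : G → G → Circle} (hω : IsTwoCocycle ω)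
    (h : ∀ g h, cocycleComm ω g h = 1) : IsTwoCoboundary ω :=
  isTwoCoboundary_of_symmetric hω fun g k => div_eq_one.1 (h g k)

theorem IsTwoCocycle.comp_zpow {ω : G → G → Circle} (hω : IsTwoCocycle ω) (b : ℤ) :
    IsTwoCocycle fun g h => ω (g ^ b) (h ^ b) := fun g h l => by
  simpa only [mul_zpow] using hω (g ^ b) (h ^ b) (l ^ b)

theorem IsTwoCocycle.zpow {ω : G → G → Circle} (hω : IsTwoCocycle ω) (n : ℤ) :
    IsTwoCocycle fun g h => ω g h ^ n := fun g h l => by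
  simp only [← mul_zpow, hω g h l]

theorem IsTwoCocycle.div {ω ω' : G → G → Circle} (hω : IsTwoCocycle ω) (hω' : IsTwoCocycle ω') :
    IsTwoCocycle fun g h => ω g h / ω' g h := fun g h l => by
  simp only [div_mul_div_comm, hω g h l, hω' g h l]

/-- On an abelian group, the pullback of a class along `g ↦ g ^ b` is its `b ^ 2`-th power. -/
theorem IsTwoCocycle.cohomologous_comp_zpow {ω : G → G → Circle} (hω : IsTwoCocycle ω) (b : ℤ) :
    Cohomologous (fun g h => ω (g ^ b) (h ^ b)) (fun g h => ω g h ^ (b ^ 2)) := by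
  refine isTwoCoboundary_of_cocycleComm_eq_one ((hω.comp_zpow b).div (hω.zpow (b ^ 2)))
    fun g h => ?_
  have h1 : cocycleComm ω (g ^ b) (h ^ b) = cocycleComm ω g h ^ (b ^ 2) := by
    rw [cocycleComm_zpow_left hω, cocycleComm_zpow_right hω, ← zpow_mul, sq]
  simp only [cocycleComm] at h1 ⊢
  rw [div_div_div_comm, h1, ← div_zpow, div_self']

end Cohomology

/-! ### Bond unitaries and the constraint on their class. -/

section Phases

variable {χ : ℕ}

theorem circle_smul_left_cancel {m n : Type*} {M : Matrix m n ℂ} (hM : M ≠ 0) {a b : Circle}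
    (h : (a : ℂ) • M = (b : ℂ) • M) : a = b :=
  Circle.coe_injective (smul_left_injective ℂ hM h)

theorem unitary_ne_zero [Nonempty (Fin χ)] (v : Matrix.unitaryGroup (Fin χ) ℂ) :
    (v : Matrix (Fin χ) (Fin χ) ℂ) ≠ 0 := by
  intro h
  have := v.2.1
  rw [h, mul_zero] at this
  exact zero_ne_one this

theorem exists_circle_of_smul_one_unitary [Nonempty (Fin χ)] {v w : Matrix.unitaryGroup (Fin χ) ℂ}
    {c : ℂ} (h : (v : Matrix (Fin χ) (Fin χ) ℂ) * (w : Matrix (Fin χ) (Fin χ) ℂ)ᴴ = c • 1) :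
    ∃ θ : Circle, (v : Matrix (Fin χ) (Fin χ) ℂ) = (θ : ℂ) • (w : Matrix (Fin χ) (Fin χ) ℂ) := by
  have hw : (w : Matrix (Fin χ) (Fin χ) ℂ)ᴴ * (w : Matrix (Fin χ) (Fin χ) ℂ) = 1 := w.2.1
  have hw' : (w : Matrix (Fin χ) (Fin χ) ℂ) * (w : Matrix (Fin χ) (Fin χ) ℂ)ᴴ = 1 := w.2.2
  have hv : (v : Matrix (Fin χ) (Fin χ) ℂ) * (v : Matrix (Fin χ) (Fin χ) ℂ)ᴴ = 1 := v.2.2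
  have hvw : (v : Matrix (Fin χ) (Fin χ) ℂ) = c • (w : Matrix (Fin χ) (Fin χ) ℂ) := by
    rw [← mul_one (v : Matrix (Fin χ) (Fin χ) ℂ), ← hw, ← Matrix.mul_assoc, h, Matrix.smul_mul,
      one_mul]
  have hc : ‖c‖ = 1 := by
    rw [hvw, Matrix.conjTranspose_smul, Matrix.smul_mul, Matrix.mul_smul, hw', smul_smul] at hv
    obtain ⟨i⟩ := ‹Nonempty (Fin χ)›
    have := congrFun (congrFun hv i) i
    simp only [Matrix.smul_apply, Matrix.one_apply_eq, smul_eq_mul, mul_one] at this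
    have h2 : ((‖c‖ ^ 2 : ℝ) : ℂ) = 1 := by
      rw [← this]; push_cast; exact (Complex.mul_conj' c).symm
    have h3 : ‖c‖ ^ 2 = 1 := by exact_mod_cast h2
    exact (pow_eq_one_iff_of_nonneg (norm_nonneg c) two_ne_zero).1 h3
  exact ⟨⟨c, mem_sphere_zero_iff_norm.2 hc⟩, hvw⟩

end Phases

section PhysAct

variable {d χ : ℕ}

theorem physAct_mul (W W' : Matrix (Fin d) (Fin d) ℂ) (A : MPSTensor d χ) :
    physAct (W * W') A = physAct W (physAct W' A) := by
  funext s
  simp only [physAct, Matrix.mul_apply, Finset.sum_smul, Finset.smul_sum, smul_smul]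
  exact Finset.sum_comm

theorem physAct_smul_mul_mul (W : Matrix (Fin d) (Fin d) ℂ) (A : MPSTensor d χ) (c : ℂ)
    (X Y : Matrix (Fin χ) (Fin χ) ℂ) (s : Fin d) :
    physAct W (fun s => c • (X * A s * Y)) s = c • (X * physAct W A s * Y) := by
  simp only [physAct, Matrix.mul_sum, Matrix.sum_mul, Finset.smul_sum, Matrix.mul_smul,
    Matrix.smul_mul, smul_smul, mul_comm c]

end PhysAct

section Symmetry

variable {G : Type*} [CommGroup G] {d χ : ℕ} {A : MPSTensor d χ}
  {U : G →* Matrix.unitaryGroup (Fin d) ℂ} {b : ℤ}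

theorem onSite_eq (g : G) (j : ℕ) :
    onSite U b g j = (U (g ^ (b ^ j)) : Matrix (Fin d) (Fin d) ℂ) := by
  rw [onSite, map_zpow]

theorem onSite_mul (g h : G) (j : ℕ) :
    onSite U b (g * h) j = onSite U b g j * onSite U b h j := by
  simp only [onSite_eq, mul_zpow, map_mul]
  rfl

theorem onSite_zpow (g : G) (j : ℕ) : onSite U b (g ^ b) j = onSite U b g (j + 1) := by
  simp only [onSite_eq, ← zpow_mul, pow_succ']

theorem onSite_add_period {L : ℕ} (h : ∀ g : G, U g ^ (b ^ L) = U g) (g : G) (j : ℕ) :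
    onSite U b g (j + L) = onSite U b g j := by
  simp only [onSite]
  rw [pow_add, mul_comm, zpow_mul, h]

theorem onSite_conjTranspose_mul (g : G) (j : ℕ) : (onSite U b g j)ᴴ * onSite U b g j = 1 :=
  (U g ^ (b ^ j)).2.1

/-- The bond unitaries of an on-site unitary symmetry of an injective MPS are unique up to
phases. -/
theorem IsInjectiveMPS.gauge_unique (hA : IsInjectiveMPS A)
    (v w : ℕ → Matrix.unitaryGroup (Fin χ) ℂ)
    (h : ∀ j, ∃ φ : Circle, ∀ s,
      (v j : Matrix (Fin χ) (Fin χ) ℂ)ᴴ * A s * (v (j + 1) : Matrix (Fin χ) (Fin χ) ℂ) =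
        (φ : ℂ) •
          ((w j : Matrix (Fin χ) (Fin χ) ℂ)ᴴ * A s * (w (j + 1) : Matrix (Fin χ) (Fin χ) ℂ)))
    (j : ℕ) : ∃ θ : Circle,
      (v j : Matrix (Fin χ) (Fin χ) ℂ) = (θ : ℂ) • (w j : Matrix (Fin χ) (Fin χ) ℂ) := by
  have := hA.nonempty
  choose φ hφ using h
  -- The discrepancy v_j w_jᴴ passes through each site up to a phase and becomes the next
  -- discrepancy, so rigidity makes it scalar.
  set u : ℕ → Matrix (Fin χ) (Fin χ) ℂ :=
    fun j => (v j : Matrix (Fin χ) (Fin χ) ℂ) * (w j : Matrix (Fin χ) (Fin χ) ℂ)ᴴ with hu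
  have hvv : ∀ j, (v j : Matrix (Fin χ) (Fin χ) ℂ) * (v j : Matrix (Fin χ) (Fin χ) ℂ)ᴴ = 1 :=
    fun j => (v j).2.2
  have hww : ∀ j, (w j : Matrix (Fin χ) (Fin χ) ℂ) * (w j : Matrix (Fin χ) (Fin χ) ℂ)ᴴ = 1 :=
    fun j => (w j).2.2
  have hpush : ∀ j s, u j * A s = (((φ j)⁻¹ : Circle) : ℂ) • (A s * u (j + 1)) := by
    intro j s
    have h1 := congrArg (fun M => (v j : Matrix (Fin χ) (Fin χ) ℂ) * M *
      (w (j + 1) : Matrix (Fin χ) (Fin χ) ℂ)ᴴ) (hφ j s)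
    have h2 : A s * u (j + 1) = (φ j : ℂ) • (u j * A s) := by
      calc _ = ((v j : Matrix (Fin χ) (Fin χ) ℂ) * (v j : Matrix (Fin χ) (Fin χ) ℂ)ᴴ) * A s *
            u (j + 1) := by rw [hvv, one_mul]
        _ = (φ j : ℂ) • (u j * A s * ((w (j + 1) : Matrix (Fin χ) (Fin χ) ℂ) *
            (w (j + 1) : Matrix (Fin χ) (Fin χ) ℂ)ᴴ)) := by
          simpa only [hu, Matrix.mul_assoc, Matrix.mul_smul, Matrix.smul_mul] using h1
        _ = _ := by rw [hww, mul_one]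
    rw [h2, smul_smul, ← Circle.coe_mul, inv_mul_cancel, Circle.coe_one, one_smul]
  have hmap : ∀ j, mixedMap A A (u j) = (((φ j)⁻¹ : Circle) : ℂ) • u (j + 1) := by
    intro j
    rw [mixedMap_apply]
    simp only [Matrix.mul_assoc, hpush, Matrix.mul_smul]
    rw [← Finset.smul_sum]
    simp only [← Matrix.mul_assoc]
    rw [← Matrix.sum_mul, hA.left_canonical, one_mul]
  have hpow : ∀ n, ∃ c : ℂ, (mixedMap A A ^ n) (u j) = c • u (j + n) := by
    intro n
    induction n with
    | zero => exact ⟨1, by simp⟩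
    | succ n ih =>
      obtain ⟨c, hc⟩ := ih
      refine ⟨c * (((φ (j + n))⁻¹ : Circle) : ℂ), ?_⟩
      rw [pow_succ', Module.End.mul_apply, hc, map_smul, hmap, smul_smul, add_assoc]
  obtain ⟨c, hc⟩ := hA.eq_smul_one_of_intertwines (X := u j) fun n s => by
    obtain ⟨c, hc⟩ := hpow n
    rw [pow_succ', Module.End.mul_apply, hc, map_smul, hmap, Matrix.smul_mul, hpush,
      Matrix.mul_smul, Matrix.mul_smul]
  exact exists_circle_of_smul_one_unitary hc

theorem IsInjectiveMPS.bond_unique (hA : IsInjectiveMPS A) (B : ℕ → MPSTensor d χ)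
    (v w : ℕ → Matrix.unitaryGroup (Fin χ) ℂ)
    (hv : ∀ j, ∃ φ : Circle, ∀ s, B j s = (φ : ℂ) •
      ((v j : Matrix (Fin χ) (Fin χ) ℂ)ᴴ * A s * (v (j + 1) : Matrix (Fin χ) (Fin χ) ℂ)))
    (hw : ∀ j, ∃ φ : Circle, ∀ s, B j s = (φ : ℂ) •
      ((w j : Matrix (Fin χ) (Fin χ) ℂ)ᴴ * A s * (w (j + 1) : Matrix (Fin χ) (Fin χ) ℂ)))
    (j : ℕ) : ∃ θ : Circle,
      (v j : Matrix (Fin χ) (Fin χ) ℂ) = (θ : ℂ) • (w j : Matrix (Fin χ) (Fin χ) ℂ) := by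
  refine hA.gauge_unique v w (fun j => ?_) j
  obtain ⟨φ, hφ⟩ := hv j
  obtain ⟨φ', hφ'⟩ := hw j
  refine ⟨φ⁻¹ * φ', fun s => ?_⟩
  rw [Circle.coe_mul, mul_smul, ← hφ' s, hφ s, smul_smul, ← Circle.coe_mul, inv_mul_cancel,
    Circle.coe_one, one_smul]

theorem physAct_onSite_mul_eq {g h : G} {j : ℕ} {φ φ' : Circle}
    {v v' w w' : Matrix.unitaryGroup (Fin χ) ℂ}
    (hg : ∀ s, physAct (onSite U b g j) A s = (φ : ℂ) •
      ((v : Matrix (Fin χ) (Fin χ) ℂ)ᴴ * A s * (v' : Matrix (Fin χ) (Fin χ) ℂ)))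
    (hh : ∀ s, physAct (onSite U b h j) A s = (φ' : ℂ) •
      ((w : Matrix (Fin χ) (Fin χ) ℂ)ᴴ * A s * (w' : Matrix (Fin χ) (Fin χ) ℂ))) (s : Fin d) :
    physAct (onSite U b (g * h) j) A s = ((φ * φ' : Circle) : ℂ) •
      (((v : Matrix (Fin χ) (Fin χ) ℂ) * (w : Matrix (Fin χ) (Fin χ) ℂ))ᴴ * A s *
        ((v' : Matrix (Fin χ) (Fin χ) ℂ) * (w' : Matrix (Fin χ) (Fin χ) ℂ))) := by
  rw [onSite_mul, physAct_mul, show physAct (onSite U b h j) A = fun s => (φ' : ℂ) •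
      ((w : Matrix (Fin χ) (Fin χ) ℂ)ᴴ * A s * (w' : Matrix (Fin χ) (Fin χ) ℂ)) from funext hh,
    physAct_smul_mul_mul, hg]
  simp only [Matrix.mul_smul, Matrix.smul_mul, smul_smul, Circle.coe_mul, mul_comm,
    Matrix.conjTranspose_mul, Matrix.mul_assoc]

/-- The gauge theorem is applied to each `g` separately. Both v(g)v(h) and v(gh) implement the
action of gh, so uniqueness up to phases gives the factor system. -/
theorem exists_isVirtualRep (hA : IsInjectiveMPS A) {L : ℕ} (hL : 0 < L)
    (hS : HasExpSymmetry A U b L) :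
    ∃ (v : ℕ → G → Matrix.unitaryGroup (Fin χ) ℂ) (ω : ℕ → G → G → Circle),
      IsVirtualRep A U b v ω := by
  have hex : ∀ g : G, ∃ v : ℕ → Matrix.unitaryGroup (Fin χ) ℂ, ∀ j s,
      physAct (onSite U b g j) A s =
        (v j : Matrix (Fin χ) (Fin χ) ℂ)ᴴ * A s * (v (j + 1) : Matrix (Fin χ) (Fin χ) ℂ) := by
    intro g
    refine hA.exists_unitary_gauge (fun j => physAct (onSite U b g j) A) (fun j => ?_) L hL
      (fun j => ?_) fun k hk => ?_
    · rw [sum_conjTranspose_mul_physAct (onSite_conjTranspose_mul g j), hA.left_canonical]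
    · simp only [onSite_add_period hS.periodic]
    · obtain ⟨θ, hθ⟩ := hS.eigenstate k hk g
      refine ⟨θ, fun s => ?_⟩
      rw [← siteTensor_mulVec_mpsState, hθ]
      rfl
  choose v hv using hex
  have hproj : ∀ (j : ℕ) (g h : G), ∃ θ : Circle,
      ((v g j * v h j : Matrix.unitaryGroup (Fin χ) ℂ) : Matrix (Fin χ) (Fin χ) ℂ) =
        (θ : ℂ) • (v (g * h) j : Matrix (Fin χ) (Fin χ) ℂ) := by
    intro j g h
    refine hA.bond_unique (fun j => physAct (onSite U b (g * h) j) A)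
      (fun j => v g j * v h j) (v (g * h)) (fun j => ⟨1 * 1, ?_⟩) (fun j => ⟨1, ?_⟩) j
    · exact physAct_onSite_mul_eq (fun s => by rw [hv]; simp) (fun s => by rw [hv]; simp)
    · intro s; rw [hv]; simp
  choose ω hω using hproj
  exact ⟨fun j g => v g j, ω, fun j g => ⟨1, fun s => by rw [hv]; simp⟩, hω⟩

theorem IsVirtualRep.proportional (hA : IsInjectiveMPS A)
    {v v' : ℕ → G → Matrix.unitaryGroup (Fin χ) ℂ} {ω ω' : ℕ → G → G → Circle}
    (hv : IsVirtualRep A U b v ω) (hv' : IsVirtualRep A U b v' ω') (j : ℕ) (g : G) :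
    ∃ θ : Circle,
      (v j g : Matrix (Fin χ) (Fin χ) ℂ) = (θ : ℂ) • (v' j g : Matrix (Fin χ) (Fin χ) ℂ) :=
  hA.bond_unique (fun j => physAct (onSite U b g j) A) (fun j => v j g) (fun j => v' j g)
    (fun j => hv.push_through j g) (fun j => hv'.push_through j g) j

/-- Shifting the chain by one site replaces `g` by `g ^ b`; both sides are bond unitaries for this
shifted action. -/
theorem IsVirtualRep.succ_proportional (hA : IsInjectiveMPS A)
    {v : ℕ → G → Matrix.unitaryGroup (Fin χ) ℂ} {ω : ℕ → G → G → Circle}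
    (hv : IsVirtualRep A U b v ω) (j : ℕ) (g : G) :
    ∃ θ : Circle, (v (j + 1) g : Matrix (Fin χ) (Fin χ) ℂ) =
      (θ : ℂ) • (v j (g ^ b) : Matrix (Fin χ) (Fin χ) ℂ) :=
  hA.bond_unique (fun j => physAct (onSite U b g (j + 1)) A) (fun j => v (j + 1) g)
    (fun j => v j (g ^ b)) (fun j => hv.push_through (j + 1) g)
    (fun j => by simpa only [onSite_zpow] using hv.push_through j (g ^ b)) j

/-- Factor systems of proportional projective representations are cohomologous. -/
theorem cohomologous_of_proportional [Nonempty (Fin χ)] {v v' : G → Matrix.unitaryGroup (Fin χ) ℂ}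
    {ω ω' : G → G → Circle}
    (hv : ∀ g h, (v g : Matrix (Fin χ) (Fin χ) ℂ) * (v h : Matrix (Fin χ) (Fin χ) ℂ) =
      (ω g h : ℂ) • (v (g * h) : Matrix (Fin χ) (Fin χ) ℂ))
    (hv' : ∀ g h, (v' g : Matrix (Fin χ) (Fin χ) ℂ) * (v' h : Matrix (Fin χ) (Fin χ) ℂ) =
      (ω' g h : ℂ) • (v' (g * h) : Matrix (Fin χ) (Fin χ) ℂ))
    (h : ∀ g, ∃ θ : Circle,
      (v g : Matrix (Fin χ) (Fin χ) ℂ) = (θ : ℂ) • (v' g : Matrix (Fin χ) (Fin χ) ℂ)) :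
    Cohomologous ω ω' := by
  choose θ hθ using h
  refine ⟨θ, fun g k => ?_⟩
  rw [div_eq_div_iff_mul_eq_mul]
  refine circle_smul_left_cancel (unitary_ne_zero (v' (g * k))) ?_
  have := hv g k
  rw [hθ g, hθ k, hθ (g * k), Matrix.smul_mul, Matrix.mul_smul, hv', smul_smul, smul_smul,
    smul_smul] at this
  push_cast
  rw [← this, mul_assoc]

theorem IsVirtualRep.isTwoCocycle [Nonempty (Fin χ)]
    {v : ℕ → G → Matrix.unitaryGroup (Fin χ) ℂ} {ω : ℕ → G → G → Circle}
    (hv : IsVirtualRep A U b v ω) (j : ℕ) : IsTwoCocycle (ω j) := by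
  intro g h l
  refine circle_smul_left_cancel (unitary_ne_zero (v j (g * h * l))) ?_
  have h1 := Matrix.mul_assoc (v j g : Matrix (Fin χ) (Fin χ) ℂ)
    (v j h : Matrix (Fin χ) (Fin χ) ℂ) (v j l : Matrix (Fin χ) (Fin χ) ℂ)
  rw [hv.projective, hv.projective, Matrix.smul_mul, Matrix.mul_smul, hv.projective,
    hv.projective, smul_smul, smul_smul, ← mul_assoc g h l] at h1
  push_cast
  exact h1

/-- A linear on-site representation forces the two bonds of a site to carry the same class. -/
theorem IsVirtualRep.cohomologous_succ (hA : IsInjectiveMPS A)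
    {v : ℕ → G → Matrix.unitaryGroup (Fin χ) ℂ} {ω : ℕ → G → G → Circle}
    (hv : IsVirtualRep A U b v ω) (j : ℕ) : Cohomologous (ω j) (ω (j + 1)) := by
  have := hA.nonempty
  obtain ⟨s, hs⟩ : ∃ s, A s ≠ 0 := by
    by_contra! h0
    have := hA.left_canonical
    simp [h0] at this
  have hpt := fun g => hv.push_through j g
  choose φ hφ using hpt
  refine ⟨φ, fun g k => ?_⟩
  rw [div_eq_div_iff_mul_eq_mul]
  set V := (v j (g * k) : Matrix (Fin χ) (Fin χ) ℂ) with hV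
  set V' := (v (j + 1) (g * k) : Matrix (Fin χ) (Fin χ) ℂ) with hV'
  have hne : Vᴴ * A s * V' ≠ 0 := by
    intro h0
    apply hs
    have e1 : V * Vᴴ = 1 := (v j (g * k)).2.2
    have e2 : V' * V'ᴴ = 1 := (v (j + 1) (g * k)).2.2
    calc A s = (V * Vᴴ) * A s * (V' * V'ᴴ) := by rw [e1, e2, one_mul, mul_one]
      _ = V * (Vᴴ * A s * V') * V'ᴴ := by simp only [Matrix.mul_assoc]
      _ = 0 := by rw [h0]; simp
  have h1 := physAct_onSite_mul_eq (hφ g) (hφ k) s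
  rw [hφ (g * k), hv.projective, hv.projective, Matrix.conjTranspose_smul, Matrix.smul_mul,
    Matrix.mul_smul, Matrix.smul_mul, smul_smul, smul_smul] at h1
  have h2 : star (ω j g k : ℂ) = (((ω j g k)⁻¹ : Circle) : ℂ) := by
    rw [Circle.coe_inv_eq_conj]; rfl
  rw [h2, ← Circle.coe_mul, ← Circle.coe_mul] at h1
  have h3 := circle_smul_left_cancel hne h1
  rw [h3, mul_comm, inv_mul_cancel_right]

theorem IsVirtualRep.cohomologous (hA : IsInjectiveMPS A)
    {v : ℕ → G → Matrix.unitaryGroup (Fin χ) ℂ} {ω : ℕ → G → G → Circle}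
    (hv : IsVirtualRep A U b v ω) (i j : ℕ) : Cohomologous (ω i) (ω j) := by
  have h0 : ∀ i, Cohomologous (ω 0) (ω i) := by
    intro i
    induction i with
    | zero => exact Cohomologous.refl _
    | succ i ih => exact ih.trans (hv.cohomologous_succ hA i)
  exact (h0 i).symm.trans (h0 j)

theorem IsVirtualRep.cohomologous_comp_zpow (hA : IsInjectiveMPS A)
    {v : ℕ → G → Matrix.unitaryGroup (Fin χ) ℂ} {ω : ℕ → G → G → Circle}
    (hv : IsVirtualRep A U b v ω) (j : ℕ) :
    Cohomologous (ω j) (fun g h => ω j (g ^ b) (h ^ b)) := by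
  have := hA.nonempty
  refine (hv.cohomologous_succ hA j).trans (cohomologous_of_proportional (v := v (j + 1))
    (v' := fun g => v j (g ^ b)) (hv.projective (j + 1)) (fun g h => ?_)
    (hv.succ_proportional hA j))
  simp only [mul_zpow]
  exact hv.projective j (g ^ b) (h ^ b)

theorem IsVirtualRep.isTwoCoboundary_zpow (hA : IsInjectiveMPS A)
    {v : ℕ → G → Matrix.unitaryGroup (Fin χ) ℂ} {ω : ℕ → G → G → Circle}
    (hv : IsVirtualRep A U b v ω) (j : ℕ) :
    IsTwoCoboundary (fun g h => ω j g h ^ (b ^ 2 - 1)) := by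
  have := hA.nonempty
  have h := ((hv.cohomologous_comp_zpow hA j).trans
    ((hv.isTwoCocycle j).cohomologous_comp_zpow b)).symm
  simpa only [Cohomologous, zpow_sub, zpow_one, div_eq_mul_inv] using h

theorem exponential_symmetry_constraint (hA : IsInjectiveMPS A) {L : ℕ} (hL : 0 < L)
    (hS : HasExpSymmetry A U b L) :
    (∃ (v : ℕ → G → Matrix.unitaryGroup (Fin χ) ℂ) (ω : ℕ → G → G → Circle),
        IsVirtualRep A U b v ω) ∧
      ∀ (v : ℕ → G → Matrix.unitaryGroup (Fin χ) ℂ) (ω : ℕ → G → G → Circle),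
        IsVirtualRep A U b v ω →
        (∀ (j : ℕ) (g : G), ∃ θ : Circle,
          (v (j + 1) g : Matrix (Fin χ) (Fin χ) ℂ) =
            (θ : ℂ) • (v j (g ^ b) : Matrix (Fin χ) (Fin χ) ℂ)) ∧
        (∀ (v' : ℕ → G → Matrix.unitaryGroup (Fin χ) ℂ) (ω' : ℕ → G → G → Circle),
          IsVirtualRep A U b v' ω' → ∀ i j : ℕ, Cohomologous (ω i) (ω' j)) ∧
        ∀ j : ℕ,
          IsTwoCocycle (ω j) ∧
          Cohomologous (ω j) (fun g h => ω j (g ^ b) (h ^ b)) ∧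
          Cohomologous (fun g h => ω j (g ^ b) (h ^ b)) (fun g h => ω j g h ^ (b ^ 2)) ∧
          IsTwoCoboundary (fun g h => ω j g h ^ (b ^ 2 - 1)) := by
  have := hA.nonempty
  refine ⟨exists_isVirtualRep hA hL hS, fun v ω hv => ⟨hv.succ_proportional hA,
    fun v' ω' hv' i j => ?_, fun j => ⟨hv.isTwoCocycle j, hv.cohomologous_comp_zpow hA j,
      (hv.isTwoCocycle j).cohomologous_comp_zpow b, hv.isTwoCoboundary_zpow hA j⟩⟩⟩
  exact (hv.cohomologous hA i j).trans
    (cohomologous_of_proportional (hv.projective j) (hv'.projective j) (hv.proportional hA hv' j))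

end Symmetry

/-! ### Realization on fixed-point tensors. -/

section Gauge

variable {d χ : ℕ}

theorem prod_ofFn_gauge (n : ℕ) (v : ℕ → Matrix.unitaryGroup (Fin χ) ℂ)
    (M : Fin n → Matrix (Fin χ) (Fin χ) ℂ) :
    (List.ofFn fun i : Fin n => (v i : Matrix (Fin χ) (Fin χ) ℂ)ᴴ * M i *
        (v (i + 1) : Matrix (Fin χ) (Fin χ) ℂ)).prod =
      (v 0 : Matrix (Fin χ) (Fin χ) ℂ)ᴴ * (List.ofFn M).prod *
        (v n : Matrix (Fin χ) (Fin χ) ℂ) := by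
  induction n generalizing v with
  | zero =>
    simp only [List.ofFn_zero, List.prod_nil, mul_one]
    exact (v 0).2.1.symm
  | succ n ih =>
    have h := ih (fun j => v (j + 1)) fun i => M i.succ
    have hv : (v 1 : Matrix (Fin χ) (Fin χ) ℂ) * (v 1 : Matrix (Fin χ) (Fin χ) ℂ)ᴴ = 1 :=
      (v 1).2.2
    rw [List.ofFn_succ, List.ofFn_succ, List.prod_cons, List.prod_cons]
    simp only [Fin.val_succ, Fin.val_zero, zero_add] at h ⊢
    rw [h]
    calc _ = (v 0 : Matrix (Fin χ) (Fin χ) ℂ)ᴴ * M 0 * ((v 1 : Matrix (Fin χ) (Fin χ) ℂ) *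
          (v 1 : Matrix (Fin χ) (Fin χ) ℂ)ᴴ) * (List.ofFn fun i => M i.succ).prod *
          (v (n + 1) : Matrix (Fin χ) (Fin χ) ℂ) := by simp only [Matrix.mul_assoc]
      _ = _ := by rw [hv]; simp only [Matrix.mul_assoc, mul_one]

/-- Interior bond unitaries cancel. The two at the ends cancel by cyclicity of the trace, which
needs `v n = v 0`. -/
theorem mpsState_eigenstate_of_gauge {A : MPSTensor d χ} (n : ℕ)
    (W : ℕ → Matrix (Fin d) (Fin d) ℂ) (v : ℕ → Matrix.unitaryGroup (Fin χ) ℂ)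
    (hv : v n = v 0)
    (h : ∀ j, ∃ φ : Circle, ∀ s, physAct (W j) A s = (φ : ℂ) •
      ((v j : Matrix (Fin χ) (Fin χ) ℂ)ᴴ * A s * (v (j + 1) : Matrix (Fin χ) (Fin χ) ℂ))) :
    ∃ θ : Circle, siteTensor n W *ᵥ mpsState A n = (θ : ℂ) • mpsState A n := by
  choose φ hφ using h
  refine ⟨∏ i : Fin n, φ i, funext fun s => ?_⟩
  rw [siteTensor_mulVec_mpsState]
  simp only [hφ]
  rw [prod_ofFn_smul n (fun i => (φ i : ℂ)), prod_ofFn_gauge n v fun i => A (s i),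
    Matrix.trace_smul, hv, Matrix.trace_mul_comm, ← Matrix.mul_assoc,
    show (v 0 : Matrix (Fin χ) (Fin χ) ℂ) * (v 0 : Matrix (Fin χ) (Fin χ) ℂ)ᴴ = 1 from (v 0).2.2,
    one_mul]
  simp only [Pi.smul_apply, mpsState]
  congr 1
  exact (map_prod Circle.coeHom _ _).symm

end Gauge

noncomputable section FixedPoint

/-- The tensor whose physical leg is a pair of virtual legs. -/
def pairTensor (n : ℕ) : MPSTensor (n * n) n := fun s =>
  ((√n : ℝ) : ℂ)⁻¹ •
    Matrix.single (finProdFinEquiv.symm s).1 (finProdFinEquiv.symm s).2 (1 : ℂ)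

theorem sqrt_inv_mul_sqrt_inv (n : ℕ) :
    ((√n : ℝ) : ℂ)⁻¹ * ((√n : ℝ) : ℂ)⁻¹ = (n : ℂ)⁻¹ := by
  rw [← mul_inv, ← Complex.ofReal_mul, Real.mul_self_sqrt n.cast_nonneg, Complex.ofReal_natCast]

theorem sum_pair {M : Type*} [AddCommMonoid M] (n : ℕ) (f : Fin n → Fin n → M) :
    ∑ s : Fin (n * n), f (finProdFinEquiv.symm s).1 (finProdFinEquiv.symm s).2 =
      ∑ i, ∑ j, f i j := by
  rw [← Fintype.sum_prod_type', ← finProdFinEquiv.symm.sum_comp]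

theorem transferMatrix_pairTensor_apply (n : ℕ) (p q : Fin n × Fin n) :
    transferMatrix (pairTensor n) p q =
      if p.1 = p.2 ∧ q.1 = q.2 then (n : ℂ)⁻¹ else 0 := by
  have h : transferMatrix (pairTensor n) = ∑ i : Fin n, ∑ j : Fin n,
      (n : ℂ)⁻¹ • (Matrix.single i j (1 : ℂ) ⊗ₖ Matrix.single i j (1 : ℂ)) := by
    rw [transferMatrix, ← sum_pair]
    refine Finset.sum_congr rfl fun s _ => ?_
    rw [← sqrt_inv_mul_sqrt_inv, pairTensor]
    ext ⟨a, b⟩ ⟨c, e⟩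
    simp only [Matrix.kronecker_apply, Matrix.smul_apply, Matrix.map_apply, smul_eq_mul,
      Matrix.single_apply, star_mul']
    split_ifs <;> simp
  rw [h]
  rcases p with ⟨a, b⟩
  rcases q with ⟨c, e⟩
  simp only [Matrix.sum_apply, Matrix.smul_apply, Matrix.kroneckerMap_apply, Matrix.single_apply,
    ite_and, mul_ite, mul_one, mul_zero, smul_eq_mul]
  simp only [Finset.sum_ite_eq', Finset.sum_ite_irrel, Finset.mem_univ, if_true,
    Finset.sum_const_zero]
  simp only [eq_comm]

theorem transferMatrix_pairTensor_mulVec (n : ℕ) (x : Fin n × Fin n → ℂ) (p : Fin n × Fin n) :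
    (transferMatrix (pairTensor n) *ᵥ x) p =
      if p.1 = p.2 then (n : ℂ)⁻¹ * ∑ j, x (j, j) else 0 := by
  simp only [Matrix.mulVec, dotProduct, transferMatrix_pairTensor_apply, Fintype.sum_prod_type,
    ite_and, ite_mul, zero_mul]
  split_ifs with h
  · simp [Finset.mul_sum]
  · simp

/-- The transfer matrix is the rank-one projection onto the identity matrix viewed as a vector, so 1
is a simple eigenvalue and any other is 0. -/
theorem isInjectiveMPS_pairTensor (n : ℕ) [NeZero n] : IsInjectiveMPS (pairTensor n) := by
  have hn : (n : ℂ) ≠ 0 := Nat.cast_ne_zero.2 (NeZero.ne n)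
  have hmul : ∀ a b c e : Fin n, Matrix.single a b (1 : ℂ) * Matrix.single c e (1 : ℂ) =
      if b = c then Matrix.single a e (1 : ℂ) else 0 := by
    intro a b c e
    split_ifs with h
    · subst h; simp
    · simp [h]
  have hone : ∑ i : Fin n, Matrix.single i i (1 : ℂ) = 1 := by
    ext a c
    simp [Matrix.sum_apply, Matrix.single_apply, Matrix.one_apply, ite_and]
  have hstar : star ((√n : ℝ) : ℂ)⁻¹ = ((√n : ℝ) : ℂ)⁻¹ := by simp
  refine ⟨?_, ⟨1, Matrix.PosDef.one, ?_⟩, ?_, ?_⟩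
  · simp only [pairTensor, Matrix.conjTranspose_smul, Matrix.conjTranspose_single, star_one,
      Matrix.smul_mul, Matrix.mul_smul, smul_smul, hstar, sqrt_inv_mul_sqrt_inv, hmul, if_true]
    rw [sum_pair n fun _ j => (n : ℂ)⁻¹ • Matrix.single j j (1 : ℂ)]
    simp only [← Finset.smul_sum, hone, Finset.sum_const, Finset.card_univ, Fintype.card_fin]
    rw [← Nat.cast_smul_eq_nsmul ℂ, smul_smul, inv_mul_cancel₀ hn, one_smul]
  · simp only [pairTensor, Matrix.conjTranspose_smul, Matrix.conjTranspose_single, star_one,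
      Matrix.smul_mul, Matrix.mul_smul, smul_smul, hstar, sqrt_inv_mul_sqrt_inv, hmul, if_true,
      mul_one]
    rw [sum_pair n fun i _ => (n : ℂ)⁻¹ • Matrix.single i i (1 : ℂ)]
    simp only [Finset.sum_const, Finset.card_univ, Fintype.card_fin]
    simp only [← Nat.cast_smul_eq_nsmul ℂ, smul_smul, mul_inv_cancel₀ hn, one_smul, hone]
  · set x₀ : Fin n × Fin n → ℂ := fun p => if p.1 = p.2 then 1 else 0 with hx₀
    have hmem : x₀ ∈ End.eigenspace (Matrix.toLin' (transferMatrix (pairTensor n))) 1 := by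
      rw [End.mem_eigenspace_iff, Matrix.toLin'_apply, one_smul]
      funext p
      rw [transferMatrix_pairTensor_mulVec]
      simp [hx₀, hn]
    refine finrank_eq_one (⟨x₀, hmem⟩ : End.eigenspace _ _) ?_ fun w => ?_
    · intro h
      have := congrFun (congrArg Subtype.val h) (0, 0)
      simp [hx₀] at this
    · refine ⟨(n : ℂ)⁻¹ * ∑ j, w.1 (j, j), Subtype.ext (funext fun p => ?_)⟩
      have hw := End.mem_eigenspace_iff.1 w.2
      rw [Matrix.toLin'_apply, one_smul] at hw
      have := congrFun hw p
      rw [transferMatrix_pairTensor_mulVec] at this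
      simp only [Submodule.coe_smul, Pi.smul_apply, smul_eq_mul, hx₀, mul_ite, mul_one, mul_zero]
      exact this
  · intro μ hμ hμ1
    obtain ⟨x, hx⟩ := hμ.exists_hasEigenvector
    have hx1 : ∀ p, (if p.1 = p.2 then (n : ℂ)⁻¹ * ∑ j, x (j, j) else 0) = μ * x p := by
      intro p
      rw [← transferMatrix_pairTensor_mulVec]
      simpa using congrFun hx.apply_eq_smul p
    have hτ : ∑ j, x (j, j) = μ * ∑ j, x (j, j) := by
      rw [Finset.mul_sum, ← Finset.sum_congr rfl fun j _ => hx1 (j, j)]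
      simp [hn]
    have hτ0 : ∑ j, x (j, j) = 0 := by
      by_contra h0
      exact hμ1 (mul_right_cancel₀ h0 (by rw [one_mul]; exact hτ.symm))
    have : μ = 0 := by
      by_contra h0
      refine hx.2 (funext fun p => ?_)
      have := hx1 p
      rw [hτ0] at this
      simpa [h0] using this.symm
    simp [this]

variable {G : Type*} [CommGroup G] {n : ℕ}

/-- The operator `c (V̄ ⊗ V')` on pairs of virtual legs. -/
def pairOp (c : Circle) (V V' : Matrix.unitaryGroup (Fin n) ℂ) :
    Matrix (Fin (n * n)) (Fin (n * n)) ℂ :=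
  (((c : ℂ) • ((starRingEnd ℂ).mapMatrix (V : Matrix (Fin n) (Fin n) ℂ) ⊗ₖ
    (V' : Matrix (Fin n) (Fin n) ℂ))).submatrix finProdFinEquiv.symm finProdFinEquiv.symm)

/-- Entrywise conjugation inverts `a`, so the product acquires the phase a'/a; `he` says that the
scalars absorb it. -/
theorem pairOp_mul (c c' e : Circle) (V V' W W' Z Z' : Matrix.unitaryGroup (Fin n) ℂ)
    {a a' : Circle}
    (h : (V : Matrix (Fin n) (Fin n) ℂ) * (W : Matrix (Fin n) (Fin n) ℂ) =
      (a : ℂ) • (Z : Matrix (Fin n) (Fin n) ℂ))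
    (h' : (V' : Matrix (Fin n) (Fin n) ℂ) * (W' : Matrix (Fin n) (Fin n) ℂ) =
      (a' : ℂ) • (Z' : Matrix (Fin n) (Fin n) ℂ)) (he : c * c' * a' = e * a) :
    pairOp c V V' * pairOp c' W W' = pairOp e Z Z' := by
  have he' : c * c' * (a⁻¹ * a') = e := by
    rw [mul_comm a⁻¹, ← mul_assoc, he, mul_inv_cancel_right]
  simp only [pairOp]
  rw [Matrix.submatrix_mul_equiv, Matrix.smul_mul, Matrix.mul_smul, ← Matrix.mul_kronecker_mul,
    ← map_mul, h, h', smul_smul]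
  have h2 : (starRingEnd ℂ).mapMatrix ((a : ℂ) • (Z : Matrix (Fin n) (Fin n) ℂ)) =
      ((a⁻¹ : Circle) : ℂ) • (starRingEnd ℂ).mapMatrix (Z : Matrix (Fin n) (Fin n) ℂ) := by
    rw [Circle.coe_inv_eq_conj]
    ext i j
    simp
  rw [h2, Matrix.smul_kronecker, Matrix.kronecker_smul, smul_smul, smul_smul, ← he']
  push_cast
  simp only [mul_assoc]

theorem pairOp_mem_unitaryGroup (c : Circle) (V V' : Matrix.unitaryGroup (Fin n) ℂ) :
    pairOp c V V' ∈ Matrix.unitaryGroup (Fin (n * n)) ℂ := by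
  rw [Matrix.mem_unitaryGroup_iff, Matrix.star_eq_conjTranspose]
  have h : (pairOp c V V')ᴴ = pairOp c⁻¹ V⁻¹ V'⁻¹ := by
    rw [pairOp, pairOp, Matrix.conjTranspose_submatrix, Matrix.conjTranspose_smul,
      Matrix.conjTranspose_kronecker, Circle.coe_inv_eq_conj]
    rfl
  have h1 : pairOp (1 : Circle) (1 : Matrix.unitaryGroup (Fin n) ℂ) 1 = 1 := by
    simp [pairOp]
  rw [h, ← h1]
  refine pairOp_mul c c⁻¹ 1 V V' V⁻¹ V'⁻¹ 1 1 (a := 1) (a' := 1) ?_ ?_ (by simp)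
  · simp
  · simp

theorem physAct_pairOp (c : Circle) (V V' : Matrix.unitaryGroup (Fin n) ℂ) (s : Fin (n * n)) :
    physAct (pairOp c V V') (pairTensor n) s =
      (c : ℂ) • ((V : Matrix (Fin n) (Fin n) ℂ)ᴴ * pairTensor n s *
        (V' : Matrix (Fin n) (Fin n) ℂ)) := by
  simp only [physAct, pairOp, pairTensor, Matrix.submatrix_apply]
  rw [sum_pair n fun i j => (((c : ℂ) • ((starRingEnd ℂ).mapMatrix (V : Matrix (Fin n) (Fin n) ℂ) ⊗ₖ
    (V' : Matrix (Fin n) (Fin n) ℂ))) (finProdFinEquiv.symm s) (i, j)) •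
      (((√n : ℝ) : ℂ)⁻¹ • Matrix.single i j (1 : ℂ))]
  ext k l
  simp only [Matrix.sum_apply, Matrix.smul_apply, Matrix.single_apply, Matrix.kroneckerMap_apply,
    smul_eq_mul, Matrix.mul_smul, Matrix.smul_mul, mul_ite, mul_one, mul_zero, ite_and]
  simp only [Finset.sum_ite_eq', Finset.sum_ite_irrel, Finset.mem_univ, if_true,
    Finset.sum_const_zero]
  have : ((V : Matrix (Fin n) (Fin n) ℂ)ᴴ *
      Matrix.single (finProdFinEquiv.symm s).1 (finProdFinEquiv.symm s).2 (1 : ℂ) *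
      (V' : Matrix (Fin n) (Fin n) ℂ)) k l =
      star ((V : Matrix (Fin n) (Fin n) ℂ) (finProdFinEquiv.symm s).1 k) *
        (V' : Matrix (Fin n) (Fin n) ℂ) (finProdFinEquiv.symm s).2 l := by
    rw [Matrix.mul_apply]
    simp [Matrix.mul_apply, Matrix.single_apply, ite_and]
  rw [this]
  simp
  ring

theorem zpow_pow_mul_period {b : ℤ} {L : ℕ} (h : ∀ g : G, g ^ (b ^ L) = g) (k : ℕ) (g : G) :
    g ^ (b ^ (k * L)) = g := by
  induction k with
  | zero => simp
  | succ k ih => rw [Nat.add_mul, one_mul, pow_add, zpow_mul, ih, h]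

/-- A projective representation `V` whose class is invariant under the pullback along
`g ↦ g ^ b` is realized on the virtual bonds of an injective MPS with exponential symmetry. -/
theorem exists_mps_of_projective [NeZero n] {b : ℤ} {L : ℕ} (hL : ∀ g : G, g ^ (b ^ L) = g)
    {ω : G → G → Circle} (hω : Cohomologous (fun g h => ω (g ^ b) (h ^ b)) ω)
    (V : G → Matrix.unitaryGroup (Fin n) ℂ)
    (hV : ∀ g h, (V g : Matrix (Fin n) (Fin n) ℂ) * (V h : Matrix (Fin n) (Fin n) ℂ) =
      (ω g h : ℂ) • (V (g * h) : Matrix (Fin n) (Fin n) ℂ))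
    (hfaith : ∀ g, (∀ i k, i ≠ k → (V g : Matrix (Fin n) (Fin n) ℂ) i k = 0) → g = 1) :
    ∃ (U : G →* Matrix.unitaryGroup (Fin (n * n)) ℂ)
      (v : ℕ → G → Matrix.unitaryGroup (Fin n) ℂ) (ω' : ℕ → G → G → Circle),
      Function.Injective U ∧ HasExpSymmetry (pairTensor n) U b L ∧
        IsVirtualRep (pairTensor n) U b v ω' ∧ ω' 0 = ω := by
  obtain ⟨β, hβ⟩ := hω
  -- The factor system of V̄(g) ⊗ V(g^b) is the coboundary of `β`; the prefactor `(β g)⁻¹` removes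
  -- it.
  let U : G →* Matrix.unitaryGroup (Fin (n * n)) ℂ :=
    MonoidHom.mk' (fun g => ⟨pairOp (β g)⁻¹ (V g) (V (g ^ b)), pairOp_mem_unitaryGroup _ _ _⟩)
      fun g h => Subtype.ext (by
        refine (pairOp_mul _ _ _ _ _ _ _ _ _ (hV g h)
          (by simpa only [mul_zpow] using hV (g ^ b) (h ^ b)) ?_).symm
        have := hβ g h
        rw [div_eq_div_iff_mul_eq_mul] at this
        rw [← mul_inv, inv_mul_eq_iff_eq_mul, mul_left_comm, eq_inv_mul_iff_mul_eq, mul_comm,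
          this])
  have hpush : ∀ (j : ℕ) (g : G), ∃ φ : Circle, ∀ s,
      physAct (onSite U b g j) (pairTensor n) s = (φ : ℂ) •
        ((V (g ^ (b ^ j)) : Matrix (Fin n) (Fin n) ℂ)ᴴ * pairTensor n s *
          (V (g ^ (b ^ (j + 1))) : Matrix (Fin n) (Fin n) ℂ)) := by
    intro j g
    refine ⟨(β (g ^ (b ^ j)))⁻¹, fun s => ?_⟩
    rw [onSite_eq, pow_succ, zpow_mul]
    exact physAct_pairOp _ _ _ s
  refine ⟨U, fun j g => V (g ^ (b ^ j)), fun j g h => ω (g ^ (b ^ j)) (h ^ (b ^ j)), ?_, ?_,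
    ⟨hpush, fun j g h => by simpa only [mul_zpow] using hV (g ^ (b ^ j)) (h ^ (b ^ j))⟩, ?_⟩
  -- An off-diagonal entry of V(g) times a nonzero entry of V(g^b) would be an off-diagonal entry of
  -- U_g. So U_g = 1 forces V(g) to be diagonal.
  · refine (injective_iff_map_eq_one U).2 fun g hg => hfaith g fun i k hik => ?_
    have : Nonempty (Fin n) := ⟨0⟩
    obtain ⟨j, l, hjl⟩ : ∃ j l, (V (g ^ b) : Matrix (Fin n) (Fin n) ℂ) j l ≠ 0 := by
      by_contra! h0
      exact unitary_ne_zero (V (g ^ b)) (Matrix.ext h0)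
    have h1 : pairOp (β g)⁻¹ (V g) (V (g ^ b)) = 1 := congrArg Subtype.val hg
    have h2 := congrFun (congrFun h1 (finProdFinEquiv (i, j))) (finProdFinEquiv (k, l))
    rw [Matrix.one_apply_ne (by simp [hik])] at h2
    simpa [pairOp, hjl] using h2
  · refine ⟨fun g => by rw [← map_zpow, hL], fun k hk g => ?_⟩
    refine mpsState_eigenstate_of_gauge (k * L) (onSite U b g) (fun j => V (g ^ (b ^ j))) ?_
      fun j => hpush j g
    simp only [zpow_pow_mul_period hL, pow_zero, zpow_one]
  · simp only [pow_zero, zpow_one]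

end FixedPoint

/-! ### The twisted regular representation. -/

noncomputable section TwistedRegular

variable {G : Type*} [CommGroup G] [Finite G]

/-- The regular representation of a finite group twisted by `ω`. -/
def twistedRegular (ω : G → G → Circle) (g : G) :
    Matrix (Fin (Nat.card G)) (Fin (Nat.card G)) ℂ :=
  open Classical in
  Matrix.of fun i j => if (Finite.equivFin G).symm i = g * (Finite.equivFin G).symm j then
    (ω g ((Finite.equivFin G).symm j) : ℂ) else 0

theorem twistedRegular_mul {ω : G → G → Circle} (hω : IsTwoCocycle ω) (g h : G) :
    twistedRegular ω g * twistedRegular ω h = (ω g h : ℂ) • twistedRegular ω (g * h) := by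
  classical
  have := Fintype.ofFinite G
  ext i j
  simp only [twistedRegular, Matrix.mul_apply, Matrix.of_apply, Matrix.smul_apply, smul_eq_mul]
  rw [(Finite.equivFin G).symm.sum_comp fun y =>
    (if (Finite.equivFin G).symm i = g * y then (ω g y : ℂ) else 0) *
      if y = h * (Finite.equivFin G).symm j then (ω h ((Finite.equivFin G).symm j) : ℂ) else 0]
  simp only [mul_ite, mul_zero, Finset.sum_ite_eq', Finset.mem_univ, if_true,
    mul_assoc g h]
  split_ifs with hi
  · have := hω g h ((Finite.equivFin G).symm j)
    rw [← Circle.coe_mul, ← Circle.coe_mul, this, mul_comm]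
  · simp

theorem twistedRegular_mem_unitaryGroup (ω : G → G → Circle) (g : G) :
    twistedRegular ω g ∈ Matrix.unitaryGroup (Fin (Nat.card G)) ℂ := by
  classical
  have := Fintype.ofFinite G
  rw [Matrix.mem_unitaryGroup_iff', Matrix.star_eq_conjTranspose]
  ext i j
  simp only [twistedRegular, Matrix.mul_apply, Matrix.conjTranspose_apply, Matrix.of_apply]
  rw [(Finite.equivFin G).symm.sum_comp fun y =>
    star (if y = g * (Finite.equivFin G).symm i then
      (ω g ((Finite.equivFin G).symm i) : ℂ) else 0) *
      if y = g * (Finite.equivFin G).symm j then (ω g ((Finite.equivFin G).symm j) : ℂ) else 0]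
  simp only [mul_ite, mul_zero, Finset.sum_ite_eq', Finset.mem_univ, if_true,
    mul_right_inj, EmbeddingLike.apply_eq_iff_eq, Matrix.one_apply]
  by_cases hij : i = j
  · subst hij
    have := Complex.conj_mul' (ω g ((Finite.equivFin G).symm i) : ℂ)
    rw [Circle.norm_coe] at this
    simpa using this
  · simp [hij, Ne.symm hij]

/-- Translation by g ≠ 1 moves the identity, producing an off-diagonal entry of modulus 1. -/
theorem eq_one_of_twistedRegular_diagonal (ω : G → G → Circle) (g : G)
    (h : ∀ i k, i ≠ k → twistedRegular ω g i k = 0) : g = 1 := by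
  by_contra hg
  have := h (Finite.equivFin G g) (Finite.equivFin G 1) (by simpa using hg)
  simp [twistedRegular] at this

/-- Every class invariant under the pullback along `g ↦ g ^ b` is carried by the virtual bonds of
an injective MPS with exponential symmetry and faithful on-site representation. -/
theorem exists_mps_of_cocycle {b : ℤ} {L : ℕ} (hL : ∀ g : G, g ^ (b ^ L) = g)
    {ω : G → G → Circle} (hc : IsTwoCocycle ω)
    (hω : Cohomologous (fun g h => ω (g ^ b) (h ^ b)) ω) :
    ∃ (d χ : ℕ) (A : MPSTensor d χ) (U : G →* Matrix.unitaryGroup (Fin d) ℂ)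
      (v : ℕ → G → Matrix.unitaryGroup (Fin χ) ℂ) (ω' : ℕ → G → G → Circle),
      Function.Injective U ∧ IsInjectiveMPS A ∧ HasExpSymmetry A U b L ∧
        IsVirtualRep A U b v ω' ∧ ω' 0 = ω := by
  have : NeZero (Nat.card G) := ⟨Nat.card_pos.ne'⟩
  obtain ⟨U, v, ω', h1, h2, h3, h4⟩ := exists_mps_of_projective hL hω
    (fun g => ⟨twistedRegular ω g, twistedRegular_mem_unitaryGroup ω g⟩)
    (twistedRegular_mul hc) (eq_one_of_twistedRegular_diagonal ω)
  exact ⟨_, _, _, U, v, ω', h1, isInjectiveMPS_pairTensor _, h2, h3, h4⟩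

end TwistedRegular

/-! ### Comparison with group cohomology. -/

open groupCohomology

section H2

variable {G : Type} [CommGroup G]

theorem isTwoCocycle_cocycleVal (x : cocycles₂ (u1Rep G)) : IsTwoCocycle (cocycleVal x) := by
  intro g h l
  have := (mem_cocycles₂_iff _).1 x.2 g h l
  have h2 : x (g * h, l) + x (g, h) = x (h, l) + x (g, h * l) := this
  have h3 := congrArg (Additive.toMul (α := Circle)) h2
  rw [mul_comm]
  exact h3

theorem H2π_eq_zero_iff_isTwoCoboundary (x : cocycles₂ (u1Rep G)) :
    H2π (u1Rep G) x = 0 ↔ IsTwoCoboundary (cocycleVal x) := by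
  rw [H2π_eq_zero_iff]
  constructor
  · rintro ⟨f, hf⟩
    refine ⟨fun g => Additive.toMul (α := Circle) (f g), fun g h => ?_⟩
    have h1 := congrFun hf (g, h)
    rw [d₁₂_hom_apply] at h1
    have h2 := congrArg (Additive.toMul (α := Circle)) h1
    refine h2.symm.trans ?_
    change Additive.toMul (α := Circle) (f h) / Additive.toMul (α := Circle) (f (g * h)) *
      Additive.toMul (α := Circle) (f g) = _
    rw [div_mul_eq_mul_div, mul_comm]
  · rintro ⟨β, hβ⟩
    refine ⟨(fun g => Additive.ofMul (β g) : G → Additive Circle), funext fun p => ?_⟩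
    apply Additive.toMul (α := Circle).injective
    refine Eq.trans ?_ (hβ p.1 p.2).symm
    change β p.2 / β (p.1 * p.2) * β p.1 = _
    rw [div_mul_eq_mul_div, mul_comm]

/-- The group cohomology class of an explicit cocycle. -/
theorem exists_cocycleVal_eq {ω : G → G → Circle} (hω : IsTwoCocycle ω) :
    ∃ x : cocycles₂ (u1Rep G), cocycleVal x = ω := by
  refine ⟨⟨fun p => Additive.ofMul (ω p.1 p.2), (mem_cocycles₂_iff _).2 fun g h l => ?_⟩, rfl⟩
  have := congrArg (Additive.ofMul (α := Circle)) (hω g h l)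
  exact (add_comm _ _).trans this

theorem H2π_surjective : Function.Surjective (H2π (u1Rep G)) :=
  (ModuleCat.epi_iff_surjective _).1 inferInstance

theorem zsmul_H2π_eq_zero_iff (n : ℤ) (x : cocycles₂ (u1Rep G)) :
    n • H2π (u1Rep G) x = 0 ↔ IsTwoCoboundary fun g h => cocycleVal x g h ^ n := by
  rw [← map_zsmul, H2π_eq_zero_iff_isTwoCoboundary]
  rfl

theorem zsmul_eq_zero_of_carriesClass {d χ : ℕ} {A : MPSTensor d χ} (hA : IsInjectiveMPS A)
    {U : G →* Matrix.unitaryGroup (Fin d) ℂ} {b : ℤ} {c : H2U1 G} (hc : CarriesClass A U b c) :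
    (b ^ 2 - 1) • c = 0 := by
  obtain ⟨v, ω, x, hv, hx, rfl⟩ := hc
  rw [zsmul_H2π_eq_zero_iff]
  simpa only [hx] using hv.isTwoCoboundary_zpow hA 0

/-- Being killed by b² - 1 is invariance under the pullback along `g ↦ g ^ b`, since that pullback
is the b²-th power. -/
theorem exists_faithful_carriesClass [Finite G] {b : ℤ} {L : ℕ}
    (hper : ∀ g : G, g ^ (b ^ L) = g) {c : H2U1 G} (hc : (b ^ 2 - 1) • c = 0) :
    ∃ (d χ : ℕ) (A : MPSTensor d χ) (U : G →* Matrix.unitaryGroup (Fin d) ℂ),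
      Function.Injective U ∧ IsInjectiveMPS A ∧ HasExpSymmetry A U b L ∧ CarriesClass A U b c := by
  obtain ⟨x, rfl⟩ := H2π_surjective c
  rw [zsmul_H2π_eq_zero_iff] at hc
  have hx := isTwoCocycle_cocycleVal x
  have h : Cohomologous (fun g h => cocycleVal x g h ^ (b ^ 2)) (cocycleVal x) := by
    simpa only [Cohomologous, zpow_sub, zpow_one, div_eq_mul_inv] using hc
  obtain ⟨d, χ, A, U, v, ω', h1, h2, h3, h4, h5⟩ :=
    exists_mps_of_cocycle hper hx ((hx.cohomologous_comp_zpow b).trans h)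
  exact ⟨d, χ, A, U, h1, h2, h3, v, ω', x, h4, fun g h => by rw [h5], rfl⟩

/-- A class is an SPT phase if and only if it is killed by `b ^ 2 - 1`. -/
theorem mem_sptPhases_iff [Finite G] {b : ℤ} {L : ℕ} (hper : ∀ g : G, g ^ (b ^ L) = g)
    (c : H2U1 G) : c ∈ sptPhases G b L ↔ (b ^ 2 - 1) • c = 0 := by
  constructor
  · rintro ⟨d, χ, A, U, hA, -, hc⟩
    exact zsmul_eq_zero_of_carriesClass hA hc
  · intro hc
    obtain ⟨d, χ, A, U, -, h2, h3, h4⟩ := exists_faithful_carriesClass hper hc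
    exact ⟨d, χ, A, U, h2, h3, h4⟩

end H2

/-! ### The classification for ℤ_N × ℤ_N. -/

section ZN2

variable {N : ℕ}

theorem exists_eq_gen_zpow_mul_gen_zpow (g : ZN2 N) :
    ∃ m n : ℤ, g = gen₁ N ^ m * gen₂ N ^ n := by
  obtain ⟨m, hm⟩ := ZMod.intCast_surjective (Multiplicative.toAdd g.1)
  obtain ⟨n, hn⟩ := ZMod.intCast_surjective (Multiplicative.toAdd g.2)
  refine ⟨m, n, Prod.ext ?_ ?_⟩
  · apply Multiplicative.toAdd.injective
    simp [gen₁, gen₂, ← hm]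
  · apply Multiplicative.toAdd.injective
    simp [gen₁, gen₂, ← hn]

theorem zpow_eq_self_of_intCast_eq_one {n : ℤ} (h : (n : ZMod N) = 1) (g : ZN2 N) : g ^ n = g := by
  refine Prod.ext ?_ ?_ <;>
  · apply Multiplicative.toAdd.injective
    simp [h]

theorem gen₁_zpow_card : gen₁ N ^ (N : ℤ) = 1 := by
  refine Prod.ext ?_ ?_ <;> simp [gen₁, ← ofAdd_nsmul]

/-- The order of b in the unit group of ℤ_N serves as the period. -/
theorem exists_period [NeZero N] {b : ℤ} (hb : IsCoprime b (N : ℤ)) :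
    ∃ L : ℕ, 0 < L ∧ ∀ g : ZN2 N, g ^ (b ^ L) = g := by
  obtain ⟨u, hu⟩ := (ZMod.coe_int_isUnit_iff_isCoprime b N).2 hb.symm
  refine ⟨orderOf u, orderOf_pos u, zpow_eq_self_of_intCast_eq_one ?_⟩
  rw [Int.cast_pow, ← hu, ← Units.val_pow_eq_pow_val, pow_orderOf_eq_one, Units.val_one]

theorem exists_toCircle_eq [NeZero N] {z : Circle} (hz : z ^ N = 1) :
    ∃ k : ZMod N, ZMod.toCircle k = z := by
  have h := (Complex.mem_rootsOfUnity N (Circle.toUnits z)).1 (by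
    rw [mem_rootsOfUnity, ← map_pow, hz, map_one])
  obtain ⟨i, -, hi⟩ := h
  refine ⟨(i : ZMod N), Circle.coe_injective ?_⟩
  rw [ZMod.toCircle_natCast, show (z : ℂ) = Circle.toUnits z from rfl, ← hi]
  congr 1
  ring

/-- The commutator is an alternating bicharacter, so its value on the pair of generators determines
it. -/
theorem isTwoCoboundary_of_cocycleComm_gen_eq_one {ω : ZN2 N → ZN2 N → Circle}
    (hω : IsTwoCocycle ω) (h : cocycleComm ω (gen₁ N) (gen₂ N) = 1) : IsTwoCoboundary ω := by
  have hself : ∀ g, cocycleComm ω g g = 1 := fun g => div_self' _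
  have h' : cocycleComm ω (gen₂ N) (gen₁ N) = 1 := by rw [cocycleComm_swap, h, inv_one]
  refine isTwoCoboundary_of_cocycleComm_eq_one hω fun g k => ?_
  obtain ⟨m, n, rfl⟩ := exists_eq_gen_zpow_mul_gen_zpow g
  obtain ⟨m', n', rfl⟩ := exists_eq_gen_zpow_mul_gen_zpow k
  simp only [cocycleComm_mul_left hω, cocycleComm_mul_right hω, cocycleComm_zpow_left hω,
    cocycleComm_zpow_right hω, h, h', hself, one_zpow, mul_one]

theorem cocycleComm_gen_pow_card {ω : ZN2 N → ZN2 N → Circle} (hω : IsTwoCocycle ω) :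
    cocycleComm ω (gen₁ N) (gen₂ N) ^ N = 1 := by
  rw [← zpow_natCast, ← cocycleComm_zpow_left hω, gen₁_zpow_card]
  exact map_one (cocycleCommHom hω (gen₂ N))

/-- The witness exp(2πi k g₁h₂/N) is bimultiplicative, hence a cocycle, and pairs only the first
coordinate of g with the second of h. -/
theorem exists_cocycle_cocycleComm_gen_eq [NeZero N] (k : ZMod N) :
    ∃ ω : ZN2 N → ZN2 N → Circle, IsTwoCocycle ω ∧
      cocycleComm ω (gen₁ N) (gen₂ N) = ZMod.toCircle k := by
  refine ⟨fun g h => ZMod.toCircle (k * (Multiplicative.toAdd g.1 * Multiplicative.toAdd h.2)),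
    fun g h l => ?_, ?_⟩
  · simp only [← AddChar.map_add_eq_mul, Prod.fst_mul, Prod.snd_mul, toAdd_mul]
    congr 1
    ring
  · simp [cocycleComm, gen₁, gen₂]

theorem exists_commutator_hom [NeZero N] :
    ∃ κ : cocycles₂ (u1Rep (ZN2 N)) →+ ZMod N,
      ∀ x, ZMod.toCircle (κ x) = cocycleComm (cocycleVal x) (gen₁ N) (gen₂ N) := by
  choose κ hκ using fun x : cocycles₂ (u1Rep (ZN2 N)) =>
    exists_toCircle_eq (cocycleComm_gen_pow_card (isTwoCocycle_cocycleVal x))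
  refine ⟨AddMonoidHom.mk' κ fun x y => ZMod.injective_toCircle ?_, hκ⟩
  rw [AddChar.map_add_eq_mul, hκ, hκ, hκ]
  exact mul_div_mul_comm _ _ _ _

/-- `H²(ℤ_N × ℤ_N, U(1)) ≃ ℤ_N`, through the commutator of the two generators. -/
theorem exists_label [NeZero N] :
    ∃ label : H2U1 (ZN2 N) ≃+ ZMod N, ∀ x : cocycles₂ (u1Rep (ZN2 N)),
      ZMod.toCircle (label (H2π (u1Rep (ZN2 N)) x)) =
        cocycleComm (cocycleVal x) (gen₁ N) (gen₂ N) := by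
  obtain ⟨κ, hκ⟩ := exists_commutator_hom (N := N)
  let π : cocycles₂ (u1Rep (ZN2 N)) →+ H2U1 (ZN2 N) :=
    (H2π (u1Rep (ZN2 N))).hom.toAddMonoidHom
  -- A coboundary on an abelian group is symmetric, so its commutator is trivial.
  have hker : π.ker ≤ κ.ker := by
    intro x hx
    obtain ⟨β, hβ⟩ := (H2π_eq_zero_iff_isTwoCoboundary x).1 hx
    apply ZMod.injective_toCircle
    rw [hκ, AddChar.map_zero_eq_one, cocycleComm, hβ, hβ, mul_comm (gen₂ N),
      mul_comm (β (gen₂ N)), div_self']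
  let f := AddMonoidHom.liftOfSurjective π H2π_surjective ⟨κ, hker⟩
  have hf : ∀ x, f (π x) = κ x :=
    AddMonoidHom.liftOfRightInverse_comp_apply π _ _ ⟨κ, hker⟩
  refine ⟨AddEquiv.ofBijective f ⟨(injective_iff_map_eq_zero f).2 fun c hc => ?_, fun k => ?_⟩,
    fun x => ?_⟩
  · obtain ⟨x, rfl⟩ := H2π_surjective c
    have h0 : κ x = 0 := (hf x).symm.trans hc
    rw [H2π_eq_zero_iff_isTwoCoboundary]
    refine isTwoCoboundary_of_cocycleComm_gen_eq_one (isTwoCocycle_cocycleVal x) ?_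
    rw [← hκ, h0, AddChar.map_zero_eq_one]
  · obtain ⟨ω, hω, hk⟩ := exists_cocycle_cocycleComm_gen_eq k
    obtain ⟨x, rfl⟩ := exists_cocycleVal_eq hω
    exact ⟨π x, (hf x).trans (ZMod.injective_toCircle ((hκ x).trans hk))⟩
  · rw [← hκ]
    exact congrArg _ (hf x)

/-- Dividing `a` and N by their gcd leaves coprime a' and q, so N ∣ a z reduces to q ∣ z; as q
divides N, this depends only on z mod N. -/
theorem intCast_mul_eq_zero_iff_exists [NeZero N] (a : ℤ) (k : ZMod N) :
    (a : ZMod N) * k = 0 ↔ ∃ m : ℤ, k = ((m * ((N / Int.gcd a N : ℕ) : ℤ) : ℤ) : ZMod N) := by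
  have hg : 0 < Int.gcd a N := Int.gcd_pos_of_ne_zero_right _ (by exact_mod_cast NeZero.ne N)
  obtain ⟨z, rfl⟩ := ZMod.intCast_surjective k
  obtain ⟨a', q, hcop, ha, hN⟩ := Int.exists_gcd_one hg
  have hq : ((N / Int.gcd a N : ℕ) : ℤ) = q := by
    rw [Int.natCast_div]
    conv_lhs => enter [1]; rw [hN]
    exact Int.mul_ediv_cancel _ (by exact_mod_cast hg.ne')
  have hgz : (Int.gcd a N : ℤ) ≠ 0 := by exact_mod_cast hg.ne'
  have h1 : ((a : ZMod N) * (z : ZMod N) = 0) ↔ q ∣ z := by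
    rw [← Int.cast_mul, ZMod.intCast_zmod_eq_zero_iff_dvd]
    conv_lhs => enter [1]; rw [hN]
    conv_lhs => enter [2]; rw [ha]
    rw [mul_right_comm, mul_dvd_mul_iff_right hgz]
    exact ⟨(Int.isCoprime_iff_gcd_eq_one.2 hcop).symm.dvd_of_dvd_mul_left, fun h => h.mul_left a'⟩
  rw [h1, hq]
  constructor
  · rintro ⟨m, rfl⟩
    exact ⟨m, by rw [mul_comm]⟩
  · rintro ⟨m, hm⟩
    rw [ZMod.intCast_eq_intCast_iff_dvd_sub] at hm
    have hqN : q ∣ (N : ℤ) := ⟨_, hN⟩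
    have := (dvd_sub_right (dvd_mul_left q m)).1 (hqN.trans hm)
    exact this

theorem label_mem_iff [NeZero N] (label : H2U1 (ZN2 N) ≃+ ZMod N) (a : ℤ) (c : H2U1 (ZN2 N)) :
    a • c = 0 ↔
      ∃ m : ℤ, label c = ((m * ((N / Int.gcd a N : ℕ) : ℤ) : ℤ) : ZMod N) := by
  rw [← intCast_mul_eq_zero_iff_exists, ← label.map_eq_zero_iff, map_zsmul, zsmul_eq_mul]

/-- Under `label` the torsion is the cyclic subgroup generated by N / gcd(a, N), whose order is
gcd(a, N). -/
theorem exists_addSubgroup_torsion [NeZero N] (label : H2U1 (ZN2 N) ≃+ ZMod N) (a : ℤ) :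
    ∃ S : AddSubgroup (H2U1 (ZN2 N)), (S : Set (H2U1 (ZN2 N))) = {c | a • c = 0} ∧
      Nonempty (S ≃+ ZMod (Int.gcd a N)) := by
  set K := AddSubgroup.zmultiples ((N / Int.gcd a N : ℕ) : ZMod N) with hK
  have hgN : Int.gcd a N ∣ N := by exact_mod_cast Int.gcd_dvd_right a N
  have hcard : Nat.card K = Int.gcd a N := by
    rw [hK, Nat.card_zmultiples, ZMod.addOrderOf_coe _ (NeZero.ne N),
      Nat.gcd_eq_right (Nat.div_dvd_of_dvd hgN), Nat.div_div_self hgN (NeZero.ne N)]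
  refine ⟨K.map label.symm.toAddMonoidHom, Set.ext fun c => ?_, ?_⟩
  · rw [SetLike.mem_coe, AddSubgroup.mem_map_equiv, AddEquiv.symm_symm, hK,
      AddSubgroup.mem_zmultiples_iff, Set.mem_ofPred_eq, label_mem_iff label]
    refine exists_congr fun m => ?_
    rw [zsmul_eq_mul, Int.cast_mul, Int.cast_natCast, eq_comm]
  · have hcyc : IsAddCyclic K := inferInstance
    exact ⟨(label.symm.addSubgroupMap K).symm.trans
      (hcard ▸ (zmodAddCyclicAddEquiv hcyc).symm)⟩

end ZN2

end ExpSPT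

/-! ### The main theorem. -/

open ExpSPT in
theorem mainTheorem4 :
    -- every symmetric injective MPS has a virtual cocycle, unique up to coboundaries, and it
    -- satisfies the constraint
    (∀ (G : Type u) [CommGroup G] (b : ℤ) (L : ℕ), 0 < L →
      ∀ (d χ : ℕ) (A : MPSTensor d χ) (U : G →* Matrix.unitaryGroup (Fin d) ℂ),
      IsInjectiveMPS A → HasExpSymmetry A U b L →
      (∃ (v : ℕ → G → Matrix.unitaryGroup (Fin χ) ℂ) (ω : ℕ → G → G → Circle),
        IsVirtualRep A U b v ω) ∧
      ∀ (v : ℕ → G → Matrix.unitaryGroup (Fin χ) ℂ) (ω : ℕ → G → G → Circle),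
        IsVirtualRep A U b v ω →
        (∀ (j : ℕ) (g : G), ∃ θ : Circle,
          (v (j + 1) g : Matrix (Fin χ) (Fin χ) ℂ) =
            (θ : ℂ) • (v j (g ^ b) : Matrix (Fin χ) (Fin χ) ℂ)) ∧
        (∀ (v' : ℕ → G → Matrix.unitaryGroup (Fin χ) ℂ) (ω' : ℕ → G → G → Circle),
          IsVirtualRep A U b v' ω' → ∀ i j : ℕ, Cohomologous (ω i) (ω' j)) ∧
        ∀ j : ℕ,
          IsTwoCocycle (ω j) ∧
          Cohomologous (ω j) (fun g h => ω j (g ^ b) (h ^ b)) ∧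
          Cohomologous (fun g h => ω j (g ^ b) (h ^ b)) (fun g h => ω j g h ^ (b ^ 2)) ∧
          IsTwoCoboundary (fun g h => ω j g h ^ (b ^ 2 - 1))) ∧
    -- the classification for `ℤ_N × ℤ_N`
    (∀ (N : ℕ), 0 < N → ∀ b : ℤ, IsCoprime b (N : ℤ) →
      (∃ L : ℕ, 0 < L ∧ ∀ g : ZN2 N, g ^ (b ^ L) = g) ∧
      ∃ label : H2U1 (ZN2 N) ≃+ ZMod N,
        (∀ (x : groupCohomology.cocycles₂ (u1Rep (ZN2 N))) (k : ℤ),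
          label (groupCohomology.H2π (u1Rep (ZN2 N)) x) = (k : ZMod N) ↔
            ((cocycleVal x (gen₁ N) (gen₂ N) / cocycleVal x (gen₂ N) (gen₁ N) : Circle) : ℂ) =
              Complex.exp (2 * Real.pi * Complex.I * k / N)) ∧
        ∀ L : ℕ, 0 < L → (∀ g : ZN2 N, g ^ (b ^ L) = g) →
          (∀ c : H2U1 (ZN2 N), c ∈ sptPhases (ZN2 N) b L ↔
            ∃ m : ℤ, label c = ((m * ((N / Int.gcd (b ^ 2 - 1) N : ℕ) : ℤ) : ℤ) : ZMod N)) ∧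
          (∀ c ∈ sptPhases (ZN2 N) b L,
            ∃ (d χ : ℕ) (A : MPSTensor d χ) (U : ZN2 N →* Matrix.unitaryGroup (Fin d) ℂ),
              Function.Injective U ∧ IsInjectiveMPS A ∧ HasExpSymmetry A U b L ∧
                CarriesClass A U b c) ∧
          ∃ S : AddSubgroup (H2U1 (ZN2 N)), (S : Set (H2U1 (ZN2 N))) = sptPhases (ZN2 N) b L ∧
            Nonempty (S ≃+ ZMod (Int.gcd (b ^ 2 - 1) N))) := by
  refine ⟨fun G _ b L hL d χ A U hA hS => exponential_symmetry_constraint hA hL hS,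
    fun N hN b hb => ?_⟩
  have : NeZero N := ⟨hN.ne'⟩
  obtain ⟨label, hlabel⟩ := exists_label (N := N)
  refine ⟨exists_period hb, label, fun x k => ?_, fun L _ hper => ⟨fun c => ?_, fun c hc => ?_, ?_⟩⟩
  · rw [← ZMod.toCircle_intCast, Circle.coe_inj, ← ZMod.injective_toCircle.eq_iff, hlabel]
    rfl
  · rw [mem_sptPhases_iff hper, label_mem_iff label]
  · exact exists_faithful_carriesClass hper ((mem_sptPhases_iff hper c).1 hc)
  · obtain ⟨S, hS, e⟩ := exists_addSubgroup_torsion label (b ^ 2 - 1)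
    exact ⟨S, hS.trans (Set.ext fun c => (mem_sptPhases_iff hper c).symm), e⟩
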